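/- Let $d \ge 5$ be an integer, and let $\Gamma = K_d(\ell)$ be the metric graph obtained from the complete graph on the vertices $v_1, \dots, v_d$ by giving its edges arbitrary lengths $\ell \in (\mathbb{R}_{>0})^{\binom{d}{2}}$. A divisor on $\Gamma$ is an element of the free abelian group on the points of $\Gamma$; it is effective if all its coefficients are non-negative, and its degree is the sum of its coefficients. A rational function on $\Gamma$ is a continuous, piecewise linear function $f : \Gamma \to \mathbb{R}$ with integer slopes and finitely many pieces, and $\operatorname{div}(f)$ is the divisor whose coefficient at $p$ is the sum of the incoming slopes of $f$ at $p$. Divisors $D_1, D_2$ are linearly equivalent if $D_1 - D_2 = \operatorname{div}(f)$ for some rational function $f$, and $|D|$ denotes the set of effective divisors linearly equivalent to $D$. The rank of $D$ is $-1$ if $|D| = \emptyset$, and otherwise it is the largest integer $r \ge 0$ such that $|D - E| \ne \emptyset$ for every effective divisor $E$ of degree $r$. Then the divisor $D = \sum_{i=1}^{d} 2\,(v_i)$ on $\Gamma$ has rank exactly $5$. -/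

import Mathlib

/-- A metric graph, given by a simple graph `graph` on the vertex set `V` together with a positive
length for each of its edges. -/
structure MetricGraph (V : Type*) where
  graph : SimpleGraph V
  length : graph.edgeSet → ℝ
  length_pos : ∀ e, 0 < length e

namespace MetricGraph

variable {V : Type*} [Fintype V] [DecidableEq V] (Γ : MetricGraph V)

/-- The length of the edge underlying an oriented edge. -/
def dartLength (e : Γ.graph.Dart) : ℝ := Γ.length ⟨e.edge, e.edge_mem⟩

/-- The underlying space of the metric graph: the geometric realization of `graph` in `V → ℝ`.
The vertex `v` is the basis vector `Pi.single v 1`, and the edge `uv` is the segment joining the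
basis vectors of `u` and `v`. The length of an edge does not enter here: it enters through the
parametrization `edgePoint`. -/
def space : Set (V → ℝ) :=
  {x | (∃ v, x = Pi.single v 1) ∨
    ∃ u v, Γ.graph.Adj u v ∧ x ∈ segment ℝ (Pi.single u 1) (Pi.single v 1)}

/-- The points of the metric graph, with the subspace topology. -/
abbrev Point : Type _ := ↥Γ.space

/-- The vertex `v`, as a point of the metric graph. -/
def vertex (v : V) : Γ.Point := ⟨Pi.single v 1, Or.inl ⟨v, rfl⟩⟩

/-- The parametrization by arc length of an oriented edge `e`: for `t ∈ [0, dartLength e]`, the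
point of `e` at distance `t` from its initial vertex `e.fst`. (Other values of `t` are first
moved to the nearest end of the interval; they are never used.) -/
noncomputable def edgePoint (e : Γ.graph.Dart) (t : ℝ) : Γ.Point :=
  ⟨AffineMap.lineMap (Pi.single e.fst 1 : V → ℝ) (Pi.single e.snd 1 : V → ℝ)
      (Set.projIcc (0 : ℝ) 1 zero_le_one (t / Γ.dartLength e) : ℝ),
    Or.inr ⟨e.fst, e.snd, e.adj, by
      rw [segment_eq_image_lineMap]
      exact Set.mem_image_of_mem _ (Subtype.coe_prop _)⟩⟩

/-- Divisors: the free abelian group on the points of the metric graph. -/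
abbrev Divisor : Type _ := Γ.Point →₀ ℤ

/-- The degree of a divisor: the sum of its coefficients. -/
def degree (D : Γ.Divisor) : ℤ := D.sum fun _ n => n

/-- `g` is linear with an integer slope on each of finitely many consecutive closed intervals
that make up `[0, L]`. -/
def IsPiecewiseLinear (g : ℝ → ℝ) (L : ℝ) : Prop :=
  ∃ (n : ℕ) (a : ℕ → ℝ), Monotone a ∧ a 0 = 0 ∧ a n = L ∧
    ∀ i < n, ∃ (m : ℤ) (c : ℝ), ∀ t ∈ Set.Icc (a i) (a (i + 1)), g t = m * t + c

/-- Rational functions: continuous functions that are piecewise linear along each edge (with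
respect to arc length), with integer slopes and finitely many pieces. -/
def IsRational (f : Γ.Point → ℝ) : Prop :=
  Continuous f ∧
    ∀ e : Γ.graph.Dart, IsPiecewiseLinear (fun t => f (Γ.edgePoint e t)) (Γ.dartLength e)

/-- The outgoing tangent directions at `p`: the oriented edges `e` on which `p` lies, other than
at the terminal vertex of `e`. There is one for each edge at a vertex `p`, and there are two (the
two orientations of the edge) at a point `p` in the interior of an edge. -/
def directions (p : Γ.Point) : Set Γ.graph.Dart :=
  {e | ∃ t ∈ Set.Ico 0 (Γ.dartLength e), Γ.edgePoint e t = p}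

/-- The outgoing slope of `f` at `p` in the direction `e`: the right derivative of `f` along `e`
at the parameter of `p`, which is `dartLength e` times the coordinate of `p` at `e.snd`. -/
noncomputable def outgoingSlope (f : Γ.Point → ℝ) (p : Γ.Point) (e : Γ.graph.Dart) : ℝ :=
  derivWithin (fun t => f (Γ.edgePoint e t))
    (Set.Ioi (Γ.dartLength e * p.1 e.snd)) (Γ.dartLength e * p.1 e.snd)

open Classical in
/-- The coefficient at `p` of the principal divisor of `f`: the sum of the incoming slopes of `f`
at `p`, that is, of the negatives of the outgoing slopes. (It is a real number by its type; it is
an integer if `f` is a rational function.) -/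
noncomputable def div (f : Γ.Point → ℝ) (p : Γ.Point) : ℝ :=
  ∑ e : Γ.graph.Dart with e ∈ Γ.directions p, -Γ.outgoingSlope f p e

/-- Linear equivalence: `D₁ - D₂` is the principal divisor of a rational function. -/
def LinearlyEquivalent (D₁ D₂ : Γ.Divisor) : Prop :=
  ∃ f : Γ.Point → ℝ, Γ.IsRational f ∧ ∀ p, (((D₁ - D₂) p : ℤ) : ℝ) = Γ.div f p

/-- The linear system of `D`: the effective divisors that are linearly equivalent to `D`. -/
def linearSystem (D : Γ.Divisor) : Set Γ.Divisor :=
  {E | 0 ≤ E ∧ Γ.LinearlyEquivalent E D}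

open Classical in
/-- The rank of a divisor: `-1` if its linear system is empty, and otherwise the largest `r` such
that the linear system of `D - E` is nonempty for every effective divisor `E` of degree `r`. -/
noncomputable def rank (D : Γ.Divisor) : ℤ :=
  if Γ.linearSystem D = ∅ then -1
  else ((sSup {r : ℕ | ∀ E : Γ.Divisor, 0 ≤ E → Γ.degree E = r →
    (Γ.linearSystem (D - E)).Nonempty} : ℕ) : ℤ)

/-- The complete metric graph `K_d(ℓ)` on `d` vertices with edge lengths `ℓ`. -/
def complete (d : ℕ) (ℓ : (⊤ : SimpleGraph (Fin d)).edgeSet → ℝ) (hℓ : ∀ e, 0 < ℓ e) :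
    MetricGraph (Fin d) where
  graph := ⊤
  length := ℓ
  length_pos := hℓ

end MetricGraph

open Filter Topology

set_option linter.unusedSectionVars false

namespace MetricGraph

variable {V : Type*} [DecidableEq V] {Γ : MetricGraph V}

/-! A rational function `f` turns a divisor `D` into `D + div f`; an outgoing slope `m` at `p` takes
`m` chips from `p` in that direction.

For the lower bound it suffices to subtract divisors supported on the vertices
(`linearSystem_sub_nonempty_of_vertices`). The key is `exists_chip_of_forall_vertex`: given members
of a linear system with a chip at either end of an edge, truncating the function between them at its
value at a point `t` of the edge gives a member with chips on both sides of `t`, and a truncated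
tent then brings one of them to `t`. What remains is to make `∑ (2 - a v) v` effective when `a ≥ 0`
has sum 5. A real potential on the vertices, extended along the edges with slopes rounded up, never
creates debt inside an edge, so only the inequality of `linearSystem_vertexDivisor_nonempty` at each
vertex matters. At most one vertex `v` is in debt, by at most 3. `exists_potential` pays it by
moving chips from all other vertices towards `v`, either at constant speed
(`exists_potential_of_const`) or, if one vertex would run out of chips, with the others refilling it
(`exists_potential_of_refill`).

For the upper bound, in degree `n > 5` the divisor `(n - 3) p + 2 q + r` cannot be subtracted. If `F
= D' + div f` is effective, with `D'` supported on the vertices, then `f` is concave along edges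
(`le_add_slope_mul`), so a vertex where `f` is minimal sends at least one chip towards each vertex
where `f` is larger. Hence `p`, `q`, `r` are successively excluded as minima, and then every vertex
is, as it would have to send three chips while owning at most two (`linearSystem_eq_empty`). -/

/-! ### Parametrization of edges and tangent directions. -/

lemma dartLength_pos (e : Γ.graph.Dart) : 0 < Γ.dartLength e := Γ.length_pos _

lemma dartLength_symm (e : Γ.graph.Dart) : Γ.dartLength e.symm = Γ.dartLength e := by
  unfold dartLength
  congr 1
  exact Subtype.ext (SimpleGraph.Dart.edge_symm e)

lemma edgePoint_coe (e : Γ.graph.Dart) {t : ℝ} (ht : t ∈ Set.Icc 0 (Γ.dartLength e)) :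
    (Γ.edgePoint e t : V → ℝ) = AffineMap.lineMap (Pi.single e.fst 1 : V → ℝ)
      (Pi.single e.snd 1 : V → ℝ) (t / Γ.dartLength e) := by
  have hL := dartLength_pos e
  have : t / Γ.dartLength e ∈ Set.Icc (0 : ℝ) 1 :=
    ⟨div_nonneg ht.1 hL.le, (div_le_one hL).2 ht.2⟩
  simp only [edgePoint, Set.projIcc_of_mem zero_le_one this]

lemma edgePoint_apply (e : Γ.graph.Dart) {t : ℝ} (ht : t ∈ Set.Icc 0 (Γ.dartLength e)) (v : V) :
    (Γ.edgePoint e t).1 v = (1 - t / Γ.dartLength e) * (if v = e.fst then 1 else 0) +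
      t / Γ.dartLength e * (if v = e.snd then 1 else 0) := by
  rw [edgePoint_coe e ht, AffineMap.lineMap_apply_module]
  simp [Pi.single_apply]

lemma edgePoint_apply_snd (e : Γ.graph.Dart) {t : ℝ} (ht : t ∈ Set.Icc 0 (Γ.dartLength e)) :
    (Γ.edgePoint e t).1 e.snd = t / Γ.dartLength e := by
  rw [edgePoint_apply e ht]; simp [e.adj.ne']

lemma edgePoint_apply_fst (e : Γ.graph.Dart) {t : ℝ} (ht : t ∈ Set.Icc 0 (Γ.dartLength e)) :
    (Γ.edgePoint e t).1 e.fst = 1 - t / Γ.dartLength e := by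
  rw [edgePoint_apply e ht]; simp [e.adj.ne]

lemma edgePoint_apply_of_ne (e : Γ.graph.Dart) {t : ℝ} (ht : t ∈ Set.Icc 0 (Γ.dartLength e))
    {v : V} (h₁ : v ≠ e.fst) (h₂ : v ≠ e.snd) : (Γ.edgePoint e t).1 v = 0 := by
  rw [edgePoint_apply e ht]; simp [h₁, h₂]

lemma dartLength_mul_edgePoint (e : Γ.graph.Dart) {t : ℝ}
    (ht : t ∈ Set.Icc 0 (Γ.dartLength e)) :
    Γ.dartLength e * (Γ.edgePoint e t).1 e.snd = t := by
  rw [edgePoint_apply_snd e ht, mul_div_cancel₀ _ (dartLength_pos e).ne']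

lemma edgePoint_symm (e : Γ.graph.Dart) {t : ℝ} (ht : t ∈ Set.Icc 0 (Γ.dartLength e)) :
    Γ.edgePoint e.symm (Γ.dartLength e - t) = Γ.edgePoint e t := by
  have hL := dartLength_pos e
  ext v
  rw [edgePoint_apply e ht, edgePoint_apply e.symm
    (by rw [dartLength_symm]; constructor <;> linarith [ht.1, ht.2]), dartLength_symm]
  change (1 - (Γ.dartLength e - t) / Γ.dartLength e) * (if v = e.snd then 1 else 0) +
    (Γ.dartLength e - t) / Γ.dartLength e * (if v = e.fst then 1 else 0) = _
  rw [sub_div, div_self hL.ne']; ring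

lemma edgePoint_symm_apply (e : Γ.graph.Dart) {t : ℝ} (ht : t ∈ Set.Icc 0 (Γ.dartLength e)) :
    Γ.edgePoint e.symm t = Γ.edgePoint e (Γ.dartLength e - t) := by
  rw [← edgePoint_symm e (t := Γ.dartLength e - t) ⟨by linarith [ht.2], by linarith [ht.1]⟩]
  congr 1; ring

lemma edgePoint_zero (e : Γ.graph.Dart) : Γ.edgePoint e 0 = Γ.vertex e.fst := by
  ext v
  rw [edgePoint_apply e ⟨le_rfl, (dartLength_pos e).le⟩]
  simp [vertex, Pi.single_apply]

lemma edgePoint_dartLength (e : Γ.graph.Dart) :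
    Γ.edgePoint e (Γ.dartLength e) = Γ.vertex e.snd := by
  rw [← edgePoint_symm e ⟨(dartLength_pos e).le, le_rfl⟩, sub_self, edgePoint_zero]
  rfl

lemma vertex_injective : Function.Injective Γ.vertex := by
  intro v w h
  have := congrArg (fun p : Γ.Point => p.1 w) h
  by_contra hne
  simp [vertex, Ne.symm hne] at this

lemma continuous_edgePoint (e : Γ.graph.Dart) : Continuous (Γ.edgePoint e) := by
  apply Continuous.subtype_mk
  have : Continuous fun t : ℝ => ((Set.projIcc (0 : ℝ) 1 zero_le_one (t / Γ.dartLength e)) : ℝ) :=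
    continuous_subtype_val.comp (continuous_projIcc.comp (continuous_id.div_const _))
  exact AffineMap.lineMap_continuous.comp this

lemma eq_vertex_or_edgePoint (p : Γ.Point) :
    (∃ v, p = Γ.vertex v) ∨ ∃ e, ∃ t ∈ Set.Ioo 0 (Γ.dartLength e), p = Γ.edgePoint e t := by
  obtain ⟨x, ⟨v, hv⟩ | ⟨u, v, huv, hx⟩⟩ := p
  · exact Or.inl ⟨v, Subtype.ext hv⟩
  · rw [segment_eq_image_lineMap] at hx
    obtain ⟨s, hs, rfl⟩ := hx
    let e : Γ.graph.Dart := ⟨(u, v), huv⟩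
    have hL := dartLength_pos e
    have key : ∀ h, (⟨AffineMap.lineMap (Pi.single u 1 : V → ℝ)
        (Pi.single v 1 : V → ℝ) s, h⟩ : Γ.Point) =
        Γ.edgePoint e (Γ.dartLength e * s) := by
      intro h
      apply Subtype.ext
      rw [edgePoint_coe e ⟨mul_nonneg hL.le hs.1, mul_le_of_le_one_right hL.le hs.2⟩,
        mul_div_cancel_left₀ _ hL.ne']
    rcases hs.1.eq_or_lt with h0 | h0
    · left; refine ⟨u, ?_⟩
      exact (key _).trans (by rw [← h0, mul_zero, edgePoint_zero])
    rcases hs.2.eq_or_lt with h1 | h1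
    · left; refine ⟨v, ?_⟩
      exact (key _).trans (by rw [h1, mul_one, edgePoint_dartLength])
    · right
      exact ⟨e, _, ⟨mul_pos hL h0, mul_lt_of_lt_one_right hL h1⟩, key _⟩

lemma mem_directions_edgePoint (e : Γ.graph.Dart) {t : ℝ}
    (ht : t ∈ Set.Ico 0 (Γ.dartLength e)) : e ∈ Γ.directions (Γ.edgePoint e t) := ⟨t, ht, rfl⟩

lemma symm_mem_directions_edgePoint (e : Γ.graph.Dart) {t : ℝ}
    (ht : t ∈ Set.Ioc 0 (Γ.dartLength e)) : e.symm ∈ Γ.directions (Γ.edgePoint e t) :=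
  ⟨Γ.dartLength e - t, by rw [dartLength_symm]; constructor <;> linarith [ht.1, ht.2],
    edgePoint_symm e ⟨ht.1.le, ht.2⟩⟩

lemma mem_directions_vertex {v : V} {e : Γ.graph.Dart} :
    e ∈ Γ.directions (Γ.vertex v) ↔ e.fst = v := by
  constructor
  · rintro ⟨t, ht, h⟩
    have h' := congrArg (fun p : Γ.Point => p.1 v) h
    simp only [vertex, Pi.single_eq_same] at h'
    have hlt : t / Γ.dartLength e < 1 := (div_lt_one (dartLength_pos e)).2 ht.2
    rw [edgePoint_apply e ⟨ht.1, ht.2.le⟩] at h'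
    by_contra hne
    rw [if_neg (Ne.symm hne)] at h'
    have := div_nonneg ht.1 (dartLength_pos e).le
    split_ifs at h' <;> linarith
  · rintro rfl
    rw [← edgePoint_zero]
    exact mem_directions_edgePoint e ⟨le_rfl, dartLength_pos e⟩

/-- An interior point has nonzero coordinates at both ends of its edge, so any oriented edge through
it has the same two ends; in a simple graph only the two orientations remain. -/
lemma mem_directions_edgePoint_iff {e e' : Γ.graph.Dart} {t : ℝ}
    (ht : t ∈ Set.Ioo 0 (Γ.dartLength e)) :
    e' ∈ Γ.directions (Γ.edgePoint e t) ↔ e' = e ∨ e' = e.symm := by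
  constructor
  · rintro ⟨t', ht', h⟩
    have hL := dartLength_pos e
    have h0 : 0 < t / Γ.dartLength e := div_pos ht.1 hL
    have h1 : t / Γ.dartLength e < 1 := (div_lt_one hL).2 ht.2
    have hs : e.snd = e'.fst ∨ e.snd = e'.snd := by
      by_contra! hne
      have := congrArg (fun p : Γ.Point => p.1 e.snd) h
      simp only [edgePoint_apply_snd e ⟨ht.1.le, ht.2.le⟩] at this
      rw [edgePoint_apply_of_ne e' ⟨ht'.1, ht'.2.le⟩ hne.1 hne.2] at this
      linarith
    have hf : e.fst = e'.fst ∨ e.fst = e'.snd := by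
      by_contra! hne
      have := congrArg (fun p : Γ.Point => p.1 e.fst) h
      simp only [edgePoint_apply_fst e ⟨ht.1.le, ht.2.le⟩] at this
      rw [edgePoint_apply_of_ne e' ⟨ht'.1, ht'.2.le⟩ hne.1 hne.2] at this
      linarith
    have hne := e.adj.ne
    rcases hs with hs | hs <;> rcases hf with hf | hf
    · exact absurd (hf.trans hs.symm) hne
    · right; apply SimpleGraph.Dart.ext; exact Prod.ext hs.symm hf.symm
    · left; apply SimpleGraph.Dart.ext; exact Prod.ext hf.symm hs.symm
    · exact absurd (hf.trans hs.symm) hne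
  · rintro (rfl | rfl)
    · exact mem_directions_edgePoint _ ⟨ht.1.le, ht.2⟩
    · exact symm_mem_directions_edgePoint _ ⟨ht.1, ht.2.le⟩

/-- The parameter of `p` along a direction `e` at `p`. -/
lemma exists_of_mem_directions {p : Γ.Point} {e : Γ.graph.Dart} (he : e ∈ Γ.directions p) :
    Γ.dartLength e * p.1 e.snd ∈ Set.Ico 0 (Γ.dartLength e) ∧
      Γ.edgePoint e (Γ.dartLength e * p.1 e.snd) = p := by
  obtain ⟨t, ht, rfl⟩ := he
  rw [dartLength_mul_edgePoint e ⟨ht.1, ht.2.le⟩]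
  exact ⟨ht, rfl⟩

/-! ### One-sided integer slopes and piecewise linearity on an interval. -/

/-- `g` is linear with integer slope `m` on a right neighbourhood of `t`. -/
def HasRightSlope (g : ℝ → ℝ) (t : ℝ) (m : ℤ) : Prop :=
  ∀ᶠ s in 𝓝[>] t, g s = g t + m * (s - t)

lemma HasRightSlope.derivWithin {g : ℝ → ℝ} {t : ℝ} {m : ℤ} (h : HasRightSlope g t m) :
    derivWithin g (Set.Ioi t) t = m := by
  have h1 : HasDerivWithinAt (fun s => g t + m * (s - t)) (m : ℝ) (Set.Ioi t) t := by
    have := (((hasDerivAt_id t).sub_const t).const_mul (m : ℝ)).const_add (g t)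
    simpa using this.hasDerivWithinAt
  exact (h1.congr_of_eventuallyEq h (by simp)).derivWithin (uniqueDiffWithinAt_Ioi t)

lemma HasRightSlope.unique {g : ℝ → ℝ} {t : ℝ} {m n : ℤ} (h : HasRightSlope g t m)
    (h' : HasRightSlope g t n) : m = n := by
  have := h.derivWithin.symm.trans h'.derivWithin
  exact_mod_cast this

lemma HasRightSlope.add {g h : ℝ → ℝ} {t : ℝ} {m n : ℤ} (hg : HasRightSlope g t m)
    (hh : HasRightSlope h t n) : HasRightSlope (fun s => g s + h s) t (m + n) := by
  filter_upwards [hg, hh] with s h1 h2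
  rw [h1, h2]; push_cast; ring

lemma HasRightSlope.neg {g : ℝ → ℝ} {t : ℝ} {m : ℤ} (hg : HasRightSlope g t m) :
    HasRightSlope (fun s => - g s) t (-m) := by
  filter_upwards [hg] with s h1
  rw [h1]; push_cast; ring

lemma hasRightSlope_linear (m : ℤ) (c t : ℝ) : HasRightSlope (fun s => m * s + c) t m :=
  Eventually.of_forall fun s => by ring

lemma hasRightSlope_const (c t : ℝ) : HasRightSlope (fun _ => c) t 0 :=
  Eventually.of_forall fun s => by simp

lemma HasRightSlope.congr {g h : ℝ → ℝ} {t : ℝ} {m : ℤ} (hg : HasRightSlope g t m)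
    (hgh : ∀ᶠ s in 𝓝[>] t, h s = g s) (ht : h t = g t) : HasRightSlope h t m := by
  filter_upwards [hg, hgh] with s h1 h2
  rw [h2, h1, ht]

lemma HasRightSlope.tendsto {g : ℝ → ℝ} {t : ℝ} {m : ℤ} (h : HasRightSlope g t m) :
    Tendsto g (𝓝[>] t) (𝓝 (g t)) := by
  have : Tendsto (fun s => g t + m * (s - t)) (𝓝[>] t) (𝓝 (g t)) := by
    have h0 : Continuous fun s : ℝ => g t + m * (s - t) := by fun_prop
    have := h0.tendsto t
    simp only [sub_self, mul_zero, add_zero] at this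
    exact this.mono_left nhdsWithin_le_nhds
  exact this.congr' (h.mono fun s hs => hs.symm)

lemma HasRightSlope.min_of_lt {g h : ℝ → ℝ} {t : ℝ} {m n : ℤ} (hg : HasRightSlope g t m)
    (hh : HasRightSlope h t n) (hlt : g t < h t) :
    HasRightSlope (fun s => min (g s) (h s)) t m := by
  refine hg.congr ?_ (min_eq_left hlt.le)
  filter_upwards [hg.tendsto.eventually_lt hh.tendsto hlt] with s hs
  exact min_eq_left hs.le

lemma HasRightSlope.min_of_eq {g h : ℝ → ℝ} {t : ℝ} {m n : ℤ} (hg : HasRightSlope g t m)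
    (hh : HasRightSlope h t n) (heq : g t = h t) :
    HasRightSlope (fun s => min (g s) (h s)) t (min m n) := by
  filter_upwards [hg, hh, self_mem_nhdsWithin] with s h1 h2 (hs : t < s)
  rw [h1, h2, heq, min_self, min_add_add_left, ← min_mul_of_nonneg _ _ (sub_pos.2 hs).le]
  push_cast; rfl

lemma HasRightSlope.exists_min {g h : ℝ → ℝ} {t : ℝ} (hg : ∃ m, HasRightSlope g t m)
    (hh : ∃ m, HasRightSlope h t m) : ∃ m, HasRightSlope (fun s => min (g s) (h s)) t m := by
  obtain ⟨m, hm⟩ := hg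
  obtain ⟨n, hn⟩ := hh
  rcases lt_trichotomy (g t) (h t) with hl | hl | hl
  · exact ⟨m, hm.min_of_lt hn hl⟩
  · exact ⟨_, hm.min_of_eq hn hl⟩
  · exact ⟨n, by simpa only [min_comm] using hn.min_of_lt hm hl⟩

lemma HasRightSlope.exists_max {g h : ℝ → ℝ} {t : ℝ} (hg : ∃ m, HasRightSlope g t m)
    (hh : ∃ m, HasRightSlope h t m) : ∃ m, HasRightSlope (fun s => max (g s) (h s)) t m := by
  obtain ⟨m, hm⟩ := hg
  obtain ⟨n, hn⟩ := hh
  obtain ⟨k, hk⟩ := HasRightSlope.exists_min ⟨_, hm.neg⟩ ⟨_, hn.neg⟩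
  refine ⟨-k, hk.neg.congr (Eventually.of_forall fun s => ?_) ?_⟩ <;>
  simp [min_neg_neg]

lemma IsPiecewiseLinear.exists_hasRightSlope {g : ℝ → ℝ} {L : ℝ} (h : IsPiecewiseLinear g L)
    {t : ℝ} (ht : t ∈ Set.Ico 0 L) : ∃ m, HasRightSlope g t m := by
  obtain ⟨n, a, ha, h0, hn, h⟩ := h
  have hex : ∃ i, t < a i := ⟨n, hn ▸ ht.2⟩
  classical
  obtain ⟨i, hi⟩ : ∃ i, i + 1 = Nat.find hex := by
    refine ⟨Nat.find hex - 1, Nat.sub_add_cancel (Nat.pos_of_ne_zero fun h' => ?_)⟩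
    have := Nat.find_spec hex
    rw [h', h0] at this
    exact absurd ht.1 (not_le.2 this)
  have h1 : t < a (i + 1) := hi ▸ Nat.find_spec hex
  have h2 : a i ≤ t := not_lt.1 (Nat.find_min hex (by omega))
  have h3 : i < n := by
    by_contra! hle
    have := ha hle
    linarith [ht.2]
  obtain ⟨m, c, hmc⟩ := h i h3
  refine ⟨m, ?_⟩
  filter_upwards [Ioo_mem_nhdsGT h1] with s hs
  rw [hmc s ⟨h2.trans hs.1.le, hs.2.le⟩, hmc t ⟨h2, h1.le⟩]; ring

/-- Compactness of `[0, L]`: linearity on each side of every point gives finitely many linear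
pieces. This makes rationality a local condition, which is easy to check for sums and minima. -/
lemma isPiecewiseLinear_of_hasRightSlope {g : ℝ → ℝ} {L : ℝ} (hL : 0 < L)
    (hr : ∀ t ∈ Set.Ico 0 L, ∃ m, HasRightSlope g t m)
    (hl : ∀ t ∈ Set.Ioc 0 L, ∃ m, HasRightSlope (fun s => g (-s)) (-t) m) :
    IsPiecewiseLinear g L := by
  have hr' : ∀ t ∈ Set.Icc 0 L, ∃ δ > 0, ∃ m : ℤ, ∀ s ∈ Set.Icc 0 L, t ≤ s → s < t + δ →
      g s = g t + m * (s - t) := by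
    intro t ht
    rcases ht.2.eq_or_lt with h | h
    -- At the right end the only admissible `s` is `L` itself, so any slope will do.
    · exact ⟨1, one_pos, 0, fun s hs h1 h2 => by rw [le_antisymm (h ▸ hs.2) h1]; simp⟩
    · obtain ⟨m, hm⟩ := hr t ⟨ht.1, h⟩
      obtain ⟨u, hu, hu'⟩ := mem_nhdsGT_iff_exists_Ioo_subset.1 hm
      refine ⟨u - t, sub_pos.2 hu, m, fun s _ h1 h2 => ?_⟩
      rcases h1.eq_or_lt with rfl | h1
      · simp
      · exact hu' ⟨h1, by linarith⟩
  have hl' : ∀ t ∈ Set.Icc 0 L, ∃ δ > 0, ∃ m : ℤ, ∀ s ∈ Set.Icc 0 L, s ≤ t → t - δ < s →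
      g s = g t + m * (s - t) := by
    intro t ht
    rcases ht.1.eq_or_lt with h | h
    · exact ⟨1, one_pos, 0, fun s hs h1 h2 => by rw [le_antisymm h1 (h ▸ hs.1)]; simp⟩
    · obtain ⟨m, hm⟩ := hl t ⟨h, ht.2⟩
      obtain ⟨u, hu, hu'⟩ := mem_nhdsGT_iff_exists_Ioo_subset.1 hm
      refine ⟨u + t, by linarith [Set.mem_Ioi.1 hu], -m, fun s _ h1 h2 => ?_⟩
      rcases h1.eq_or_lt with rfl | h1
      · simp
      · have := hu' (show -s ∈ Set.Ioo (-t) u from ⟨by linarith, by linarith⟩)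
        simp only [Set.mem_ofPred_eq, neg_neg] at this
        rw [this]; push_cast; ring
  choose! δ₁ hδ₁ m₁ h₁ using hr'
  choose! δ₂ hδ₂ m₂ h₂ using hl'
  obtain ⟨t, ht0, htm, ⟨N, hN⟩, hc⟩ := exists_monotone_Icc_subset_open_cover_Icc hL.le
    (c := fun x : Set.Icc 0 L => {s | x.1 - δ₂ x.1 < s.1 ∧ s.1 < x.1 + δ₁ x.1})
    (fun x => (isOpen_lt continuous_const continuous_subtype_val).inter
      (isOpen_lt continuous_subtype_val continuous_const))
    (fun x _ => Set.mem_iUnion.2 ⟨x, by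
      constructor <;> linarith [hδ₁ x.1 x.2, hδ₂ x.1 x.2]⟩)
  choose x hx using hc
  have htm' : ∀ n, (t n : ℝ) ≤ t (n + 1) := fun n => htm (Nat.le_succ n)
  -- Each cell of the subdivision lies in the neighbourhood of some centre `x n`, with one slope on
  -- each side of it. The cell is split at the centre, clamped to the cell in case the centre lies
  -- outside.
  let y : ℕ → ℝ := fun n => max (t n) (min (x n) (t (n + 1)))
  have hy1 : ∀ n, (t n : ℝ) ≤ y n := fun n => le_max_left _ _
  have hy2 : ∀ n, y n ≤ t (n + 1) := fun n => max_le (htm' n) (min_le_right _ _)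
  -- Interleaving the cell ends with the clamped centres gives `2 * N` pieces.
  let a : ℕ → ℝ := fun k => if k % 2 = 0 then t (k / 2) else y (k / 2)
  have ha0 : ∀ n, a (2 * n) = t n := fun n => by simp [a]
  have ha1 : ∀ n, a (2 * n + 1) = y n := fun n => by
    simp only [a]; rw [if_neg (by omega)]; congr 1; omega
  have ha2 : ∀ n, a (2 * n + 1 + 1) = t (n + 1) := fun n => ha0 (n + 1)
  have hpar : ∀ k, ∃ n, k = 2 * n ∨ k = 2 * n + 1 := fun k => ⟨k / 2, by omega⟩
  refine ⟨2 * N, a, monotone_nat_of_le_succ fun k => ?_, ?_, ?_, fun k _ => ?_⟩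
  · obtain ⟨n, rfl | rfl⟩ := hpar k
    · rw [ha0, ha1]; exact hy1 n
    · rw [ha1, ha2]; exact hy2 n
  · rw [← mul_zero 2, ha0, ht0]
  · rw [ha0, hN N le_rfl]
  · have hcov : ∀ n s, (t n : ℝ) ≤ s → s ≤ t (n + 1) →
        s ∈ Set.Icc 0 L ∧ (x n).1 - δ₂ (x n).1 < s ∧ s < (x n).1 + δ₁ (x n).1 := by
      intro n s hs1 hs2
      have hs : s ∈ Set.Icc 0 L := ⟨(t n).2.1.trans hs1, hs2.trans (t (n + 1)).2.2⟩
      exact ⟨hs, hx n (show (⟨s, hs⟩ : Set.Icc 0 L) ∈ Set.Icc (t n) (t (n + 1)) from ⟨hs1, hs2⟩)⟩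
    obtain ⟨n, rfl | rfl⟩ := hpar k
    · rw [ha0, ha1]
      rcases le_total (t n : ℝ) (x n) with hle | hle
      · refine ⟨m₂ (x n), g (x n) - m₂ (x n) * x n, fun s hs => ?_⟩
        obtain ⟨hs0, hs1, hs2⟩ := hcov n s hs.1 (hs.2.trans (hy2 n))
        have : s ≤ x n := hs.2.trans (max_le hle (min_le_left _ _))
        rw [h₂ _ (x n).2 s hs0 this hs1]; ring
      · refine ⟨0, g (t n), fun s hs => ?_⟩
        have : s = t n := le_antisymm (hs.2.trans (max_le le_rfl ((min_le_left _ _).trans hle))) hs.1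
        simp [this]
    · rw [ha1, ha2]
      rcases le_total (x n : ℝ) (t (n + 1)) with hle | hle
      · refine ⟨m₁ (x n), g (x n) - m₁ (x n) * x n, fun s hs => ?_⟩
        obtain ⟨hs0, hs1, hs2⟩ := hcov n s ((hy1 n).trans hs.1) hs.2
        have : x n ≤ s := by
          refine le_trans ?_ hs.1
          simp only [y]
          rw [min_eq_left hle]
          exact le_max_right _ _
        rw [h₁ _ (x n).2 s hs0 this hs2]; ring
      · refine ⟨0, g (t (n + 1)), fun s hs => ?_⟩
        have : s = t (n + 1) := by
          refine le_antisymm hs.2 (le_trans ?_ hs.1)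
          simp only [y]
          rw [min_eq_right hle]
          exact le_max_right _ _
        simp [this]

lemma IsPiecewiseLinear.exists_finite {g : ℝ → ℝ} {L : ℝ} (h : IsPiecewiseLinear g L) :
    ∃ S : Set ℝ, S.Finite ∧ ∀ t ∈ Set.Ioo 0 L, t ∉ S →
      ∃ (m : ℤ) (c : ℝ), ∀ᶠ s in 𝓝 t, g s = m * s + c := by
  obtain ⟨n, a, ha, h0, hn, h⟩ := h
  refine ⟨a '' Set.Iic n, (Set.finite_Iic n).image a, fun t ht htS => ?_⟩
  have hex : ∃ i, t < a i := ⟨n, hn ▸ ht.2⟩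
  classical
  obtain ⟨i, hi⟩ : ∃ i, i + 1 = Nat.find hex := by
    refine ⟨Nat.find hex - 1, Nat.sub_add_cancel (Nat.pos_of_ne_zero fun h' => ?_)⟩
    have := Nat.find_spec hex
    rw [h', h0] at this
    exact absurd ht.1.le (not_le.2 this)
  have h1 : t < a (i + 1) := hi ▸ Nat.find_spec hex
  have h2 : a i ≤ t := not_lt.1 (Nat.find_min hex (by omega))
  have h3 : i < n := by
    by_contra! hle
    have := ha hle
    linarith [ht.2]
  have h4 : a i < t := lt_of_le_of_ne h2 fun h => htS ⟨i, h3.le, h⟩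
  obtain ⟨m, c, hmc⟩ := h i h3
  exact ⟨m, c, by filter_upwards [Icc_mem_nhds h4 h1] with s hs using hmc s hs⟩

/-! ### Slopes and divisors of rational functions. -/

variable [Fintype V]

lemma eventually_nhdsGT_iff_add {P : ℝ → Prop} (t : ℝ) :
    (∀ᶠ s in 𝓝[>] t, P s) ↔ ∀ᶠ ε in 𝓝[>] (0 : ℝ), P (t + ε) := by
  have h : map (fun ε => t + ε) (𝓝[>] (0 : ℝ)) = 𝓝[>] t := by simp
  rw [← h, eventually_map]

lemma hasRightSlope_iff {g : ℝ → ℝ} {t : ℝ} {m : ℤ} :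
    HasRightSlope g t m ↔ ∀ᶠ ε in 𝓝[>] (0 : ℝ), g (t + ε) = g t + m * ε := by
  unfold HasRightSlope
  rw [eventually_nhdsGT_iff_add]
  simp

lemma eventually_edgePoint_symm (f : Γ.Point → ℝ) (e : Γ.graph.Dart) {t : ℝ}
    (ht : t ∈ Set.Ioc 0 (Γ.dartLength e)) : ∀ᶠ ε in 𝓝[>] (0 : ℝ),
      f (Γ.edgePoint e.symm (Γ.dartLength e - t + ε)) = f (Γ.edgePoint e (t - ε)) := by
  filter_upwards [Ioo_mem_nhdsGT ht.1] with ε hε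
  rw [edgePoint_symm_apply e ⟨by linarith [hε.1, ht.2], by linarith [hε.2]⟩]
  congr 2; ring

/-- Expresses a slope along the reversed edge in the parameter of `e`, so that both directions at a
point are handled in one coordinate. -/
lemma hasRightSlope_symm_iff {f : Γ.Point → ℝ} {e : Γ.graph.Dart} {t : ℝ} {m : ℤ}
    (ht : t ∈ Set.Ioc 0 (Γ.dartLength e)) :
    HasRightSlope (fun s => f (Γ.edgePoint e.symm s)) (Γ.dartLength e - t) m ↔
      ∀ᶠ ε in 𝓝[>] (0 : ℝ), f (Γ.edgePoint e (t - ε)) = f (Γ.edgePoint e t) + m * ε := by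
  rw [hasRightSlope_iff]
  refine eventually_congr ?_
  filter_upwards [eventually_edgePoint_symm f e ht] with ε hε
  rw [hε, edgePoint_symm e ⟨ht.1.le, ht.2⟩]

/-- `f` has the outgoing slope `m` at `p` in the direction `e`. -/
def HasSlope (f : Γ.Point → ℝ) (p : Γ.Point) (e : Γ.graph.Dart) (m : ℤ) : Prop :=
  HasRightSlope (fun t => f (Γ.edgePoint e t)) (Γ.dartLength e * p.1 e.snd) m

lemma HasSlope.outgoingSlope {f : Γ.Point → ℝ} {p : Γ.Point} {e : Γ.graph.Dart} {m : ℤ}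
    (h : HasSlope f p e m) : Γ.outgoingSlope f p e = m := h.derivWithin

lemma hasSlope_edgePoint {f : Γ.Point → ℝ} {e : Γ.graph.Dart} {t : ℝ} {m : ℤ}
    (ht : t ∈ Set.Icc 0 (Γ.dartLength e)) : HasSlope f (Γ.edgePoint e t) e m ↔
      HasRightSlope (fun t => f (Γ.edgePoint e t)) t m := by
  unfold HasSlope
  rw [dartLength_mul_edgePoint e ht]

lemma hasSlope_edgePoint_symm {f : Γ.Point → ℝ} {e : Γ.graph.Dart} {t : ℝ} {m : ℤ}
    (ht : t ∈ Set.Ioc 0 (Γ.dartLength e)) : HasSlope f (Γ.edgePoint e t) e.symm m ↔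
      ∀ᶠ ε in 𝓝[>] (0 : ℝ), f (Γ.edgePoint e (t - ε)) = f (Γ.edgePoint e t) + m * ε := by
  rw [← hasRightSlope_symm_iff ht, ← edgePoint_symm e ⟨ht.1.le, ht.2⟩, hasSlope_edgePoint]
  rw [dartLength_symm]; constructor <;> linarith [ht.1, ht.2]

lemma isRational_iff {f : Γ.Point → ℝ} : Γ.IsRational f ↔
    Continuous f ∧ ∀ p, ∀ e ∈ Γ.directions p, ∃ m, HasSlope f p e m := by
  refine and_congr_right fun hf => ⟨fun h p e he => ?_, fun h e => ?_⟩
  · exact (h e).exists_hasRightSlope (exists_of_mem_directions he).1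
  · refine isPiecewiseLinear_of_hasRightSlope (dartLength_pos e) (fun t ht => ?_) fun t ht => ?_
    · obtain ⟨m, hm⟩ := h _ e (mem_directions_edgePoint e ht)
      exact ⟨m, (hasSlope_edgePoint ⟨ht.1, ht.2.le⟩).1 hm⟩
    · obtain ⟨m, hm⟩ := h _ e.symm (symm_mem_directions_edgePoint e ht)
      refine ⟨m, hasRightSlope_iff.2 ?_⟩
      filter_upwards [(hasSlope_edgePoint_symm ht).1 hm] with ε hε
      rw [neg_add, neg_neg, ← sub_eq_add_neg, hε]

lemma IsRational.exists_slopes {f : Γ.Point → ℝ} (hf : Γ.IsRational f) (p : Γ.Point) :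
    ∃ m : Γ.graph.Dart → ℤ, ∀ e ∈ Γ.directions p, HasSlope f p e (m e) := by
  have := (isRational_iff.1 hf).2 p
  choose! m hm using this
  exact ⟨m, hm⟩

open Classical in
lemma div_eq {f : Γ.Point → ℝ} {p : Γ.Point} {m : Γ.graph.Dart → ℤ}
    (h : ∀ e ∈ Γ.directions p, HasSlope f p e (m e)) :
    Γ.div f p = ((∑ e : Γ.graph.Dart with e ∈ Γ.directions p, -m e : ℤ) : ℝ) := by
  unfold div
  push_cast
  refine Finset.sum_congr rfl fun e he => ?_
  rw [(h e (Finset.mem_filter.1 he).2).outgoingSlope]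

open Classical in
lemma div_le_div {f g : Γ.Point → ℝ} {p : Γ.Point} {m n : Γ.graph.Dart → ℤ}
    (hf : ∀ e ∈ Γ.directions p, HasSlope f p e (m e))
    (hg : ∀ e ∈ Γ.directions p, HasSlope g p e (n e))
    (h : ∀ e ∈ Γ.directions p, n e ≤ m e) : Γ.div f p ≤ Γ.div g p := by
  rw [div_eq hf, div_eq hg]
  rw [Int.cast_le]
  apply Finset.sum_le_sum
  intro e he
  apply neg_le_neg (h e _)
  exact (Finset.mem_filter.1 he).2

lemma HasSlope.add {f g : Γ.Point → ℝ} {p : Γ.Point} {e : Γ.graph.Dart} {m n : ℤ}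
    (hf : HasSlope f p e m) (hg : HasSlope g p e n) : HasSlope (fun q => f q + g q) p e (m + n) :=
  HasRightSlope.add hf hg

lemma HasSlope.neg {f : Γ.Point → ℝ} {p : Γ.Point} {e : Γ.graph.Dart} {m : ℤ}
    (hf : HasSlope f p e m) : HasSlope (fun q => - f q) p e (-m) :=
  HasRightSlope.neg hf

lemma hasSlope_const (c : ℝ) (p : Γ.Point) (e : Γ.graph.Dart) : HasSlope (fun _ => c) p e 0 :=
  hasRightSlope_const c _

lemma div_const (c : ℝ) (p : Γ.Point) : Γ.div (fun _ => c) p = 0 := by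
  rw [div_eq (m := 0) fun e _ => hasSlope_const c p e]; simp

lemma isRational_const (c : ℝ) : Γ.IsRational fun _ => c :=
  isRational_iff.2 ⟨continuous_const, fun p e _ => ⟨0, hasSlope_const c p e⟩⟩

lemma IsRational.add {f g : Γ.Point → ℝ} (hf : Γ.IsRational f) (hg : Γ.IsRational g) :
    Γ.IsRational fun p => f p + g p := by
  rw [isRational_iff] at *
  refine ⟨hf.1.add hg.1, fun p e he => ?_⟩
  obtain ⟨m, hm⟩ := hf.2 p e he
  obtain ⟨n, hn⟩ := hg.2 p e he
  exact ⟨_, HasRightSlope.add hm hn⟩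

lemma IsRational.neg {f : Γ.Point → ℝ} (hf : Γ.IsRational f) :
    Γ.IsRational fun p => - f p := by
  rw [isRational_iff] at *
  refine ⟨hf.1.neg, fun p e he => ?_⟩
  obtain ⟨m, hm⟩ := hf.2 p e he
  exact ⟨_, HasRightSlope.neg hm⟩

lemma IsRational.min {f g : Γ.Point → ℝ} (hf : Γ.IsRational f) (hg : Γ.IsRational g) :
    Γ.IsRational fun p => Min.min (f p) (g p) := by
  rw [isRational_iff] at *
  exact ⟨hf.1.min hg.1, fun p e he => HasRightSlope.exists_min (hf.2 p e he) (hg.2 p e he)⟩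

lemma div_add {f g : Γ.Point → ℝ} (hf : Γ.IsRational f) (hg : Γ.IsRational g) (p : Γ.Point) :
    Γ.div (fun p => f p + g p) p = Γ.div f p + Γ.div g p := by
  obtain ⟨m, hm⟩ := hf.exists_slopes p
  obtain ⟨n, hn⟩ := hg.exists_slopes p
  rw [div_eq hm, div_eq hn, div_eq (m := m + n) fun e he => (hm e he).add (hn e he),
    ← Int.cast_add, ← Finset.sum_add_distrib]
  congr 1
  exact Finset.sum_congr rfl fun e _ => by simp only [Pi.add_apply]; ring

lemma div_neg {f : Γ.Point → ℝ} (hf : Γ.IsRational f) (p : Γ.Point) :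
    Γ.div (fun p => - f p) p = - Γ.div f p := by
  obtain ⟨m, hm⟩ := hf.exists_slopes p
  rw [div_eq hm, div_eq (m := -m) fun e he => (hm e he).neg, ← Int.cast_neg,
    ← Finset.sum_neg_distrib]
  rfl

lemma edgePoint_eq_of_mem_directions {p : Γ.Point} {e : Γ.graph.Dart}
    (he : e ∈ Γ.directions p) : Γ.edgePoint e (Γ.dartLength e * p.1 e.snd) = p :=
  (exists_of_mem_directions he).2

/-- At a point, a minimum has outgoing slopes no larger than those of whichever function attains it
there. Since `div` sums the negatives of these slopes, truncation can only add chips relative to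
that function; this keeps truncated divisors effective. -/
lemma exists_slopes_min_const {f : Γ.Point → ℝ} (c : ℝ) {p : Γ.Point}
    {m : Γ.graph.Dart → ℤ} (hm : ∀ e ∈ Γ.directions p, HasSlope f p e (m e)) :
    ∃ n : Γ.graph.Dart → ℤ, (∀ e ∈ Γ.directions p, HasSlope (fun q => min (f q) c) p e (n e)) ∧
      (f p ≤ c → ∀ e, n e ≤ m e) ∧ (c ≤ f p → ∀ e, n e ≤ 0) := by
  have hv : ∀ e ∈ Γ.directions p, f (Γ.edgePoint e (Γ.dartLength e * p.1 e.snd)) = f p :=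
    fun e he => by rw [edgePoint_eq_of_mem_directions he]
  rcases lt_trichotomy (f p) c with h | h | h
  · exact ⟨m, fun e he => HasRightSlope.min_of_lt (hm e he) (hasRightSlope_const c _)
      (by rwa [hv e he]), fun _ _ => le_rfl, fun h' => absurd h (not_lt.2 h')⟩
  · exact ⟨fun e => min (m e) 0, fun e he => HasRightSlope.min_of_eq (hm e he)
      (hasRightSlope_const c _) (by rwa [hv e he]), fun _ _ => min_le_left _ _,
      fun _ _ => min_le_right _ _⟩
  · refine ⟨0, fun e he => ?_, fun h' => absurd h (not_lt.2 h'), fun _ _ => le_rfl⟩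
    have := HasRightSlope.min_of_lt (hasRightSlope_const c _) (hm e he) (by rwa [hv e he])
    unfold HasSlope
    simpa only [min_comm, Pi.zero_apply] using this

lemma div_nonneg_min_const {f : Γ.Point → ℝ} (hf : Γ.IsRational f) {c : ℝ} {p : Γ.Point}
    (h : c ≤ f p) : 0 ≤ Γ.div (fun q => min (f q) c) p := by
  obtain ⟨m, hm⟩ := hf.exists_slopes p
  obtain ⟨n, hn, -, h2⟩ := exists_slopes_min_const c hm
  rw [← div_const c p]
  exact div_le_div (m := 0) (fun e _ => hasSlope_const c p e) hn fun e _ => h2 h e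

lemma div_le_div_min_const {f : Γ.Point → ℝ} (hf : Γ.IsRational f) {c : ℝ} {p : Γ.Point}
    (h : f p ≤ c) : Γ.div f p ≤ Γ.div (fun q => min (f q) c) p := by
  obtain ⟨m, hm⟩ := hf.exists_slopes p
  obtain ⟨n, hn, h1, -⟩ := exists_slopes_min_const c hm
  exact div_le_div hm hn fun e _ => h1 h e

lemma one_le_div_min_const {f : Γ.Point → ℝ} (hf : Γ.IsRational f) {c : ℝ} {p : Γ.Point}
    (h : f p = c) {e : Γ.graph.Dart} (he : e ∈ Γ.directions p) {k : ℤ} (hk : HasSlope f p e k)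
    (hk0 : k < 0) : 1 ≤ Γ.div (fun q => min (f q) c) p := by
  classical
  obtain ⟨m, hm⟩ := hf.exists_slopes p
  obtain ⟨n, hn, h1, h2⟩ := exists_slopes_min_const c hm
  have hke : k = m e := hk.unique (hm e he)
  rw [div_eq hn]
  have hne : 1 ≤ -n e := by have := h1 h.le e; omega
  have := Finset.single_le_sum (f := fun e => - n e) (fun e _ => neg_nonneg.2 (h2 h.ge e))
    (Finset.mem_filter.2 ⟨Finset.mem_univ e, he⟩)
  exact_mod_cast hne.trans (by convert this)

lemma IsRational.exists_int_eq_div {f : Γ.Point → ℝ} (hf : Γ.IsRational f) (p : Γ.Point) :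
    ∃ n : ℤ, (n : ℝ) = Γ.div f p := by
  obtain ⟨m, hm⟩ := hf.exists_slopes p
  exact ⟨_, (div_eq hm).symm⟩

lemma div_edgePoint {f : Γ.Point → ℝ} {e : Γ.graph.Dart} {t : ℝ} {m n : ℤ}
    (ht : t ∈ Set.Ioo 0 (Γ.dartLength e)) (hm : HasSlope f (Γ.edgePoint e t) e m)
    (hn : HasSlope f (Γ.edgePoint e t) e.symm n) :
    Γ.div f (Γ.edgePoint e t) = ((-m - n : ℤ) : ℝ) := by
  classical
  have h : (Finset.univ.filter fun e' => e' ∈ Γ.directions (Γ.edgePoint e t)) = {e, e.symm} := by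
    ext e'
    simp [mem_directions_edgePoint_iff ht]
  unfold div
  have hs := hm.outgoingSlope
  have hs' := hn.outgoingSlope
  have := Finset.sum_pair (f := fun e' => -Γ.outgoingSlope f (Γ.edgePoint e t) e')
    e.symm_ne.symm
  rw [← h] at this
  convert this using 1
  rw [hs, hs']; push_cast; ring

/-- The sum of the two outgoing slopes is the coefficient of `ε` in a symmetric second difference,
so signs of `div` inside an edge follow from midpoint concavity without finding either slope. -/
lemma IsRational.exists_second_difference {f : Γ.Point → ℝ} (hf : Γ.IsRational f)
    {e : Γ.graph.Dart} {t : ℝ} (ht : t ∈ Set.Ioo 0 (Γ.dartLength e)) :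
    ∃ k : ℤ, Γ.div f (Γ.edgePoint e t) = -k ∧ ∀ᶠ ε in 𝓝[>] (0 : ℝ),
      f (Γ.edgePoint e (t + ε)) + f (Γ.edgePoint e (t - ε)) =
        2 * f (Γ.edgePoint e t) + k * ε := by
  have hr := (isRational_iff.1 hf).2 (Γ.edgePoint e t)
  obtain ⟨m, hm⟩ := hr e (mem_directions_edgePoint e ⟨ht.1.le, ht.2⟩)
  obtain ⟨n, hn⟩ := hr e.symm (symm_mem_directions_edgePoint e ⟨ht.1, ht.2.le⟩)
  refine ⟨m + n, by rw [div_edgePoint ht hm hn]; push_cast; ring, ?_⟩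
  filter_upwards [hasRightSlope_iff.1 ((hasSlope_edgePoint ⟨ht.1.le, ht.2.le⟩).1 hm),
    (hasSlope_edgePoint_symm ⟨ht.1, ht.2.le⟩).1 hn] with ε h1 h2
  rw [h1, h2]; push_cast; ring

lemma IsRational.div_edgePoint_nonneg {f : Γ.Point → ℝ} (hf : Γ.IsRational f)
    {e : Γ.graph.Dart} {t : ℝ} (ht : t ∈ Set.Ioo 0 (Γ.dartLength e))
    (h : ∀ᶠ ε in 𝓝[>] (0 : ℝ), f (Γ.edgePoint e (t + ε)) + f (Γ.edgePoint e (t - ε)) ≤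
      2 * f (Γ.edgePoint e t)) : 0 ≤ Γ.div f (Γ.edgePoint e t) := by
  obtain ⟨k, hk, hk'⟩ := hf.exists_second_difference ht
  obtain ⟨ε, h1, h2, h3⟩ := (h.and (hk'.and self_mem_nhdsWithin)).exists
  rw [hk, neg_nonneg]
  by_contra! h5
  linarith [mul_pos h5 h3]

lemma IsRational.one_le_div_edgePoint {f : Γ.Point → ℝ} (hf : Γ.IsRational f)
    {e : Γ.graph.Dart} {t : ℝ} (ht : t ∈ Set.Ioo 0 (Γ.dartLength e))
    (h : ∀ᶠ ε in 𝓝[>] (0 : ℝ), f (Γ.edgePoint e (t + ε)) + f (Γ.edgePoint e (t - ε)) <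
      2 * f (Γ.edgePoint e t)) : 1 ≤ Γ.div f (Γ.edgePoint e t) := by
  obtain ⟨k, hk, hk'⟩ := hf.exists_second_difference ht
  obtain ⟨ε, h1, h2, h3⟩ := (h.and (hk'.and self_mem_nhdsWithin)).exists
  have : (k : ℝ) < 0 := by
    by_contra! h5
    linarith [mul_nonneg h5 (le_of_lt h3)]
  have : k < 0 := by exact_mod_cast this
  rw [hk]
  exact_mod_cast (by omega : 1 ≤ -k)

/-- The principal divisor of a rational function, as a divisor. -/
lemma IsRational.exists_divisor {f : Γ.Point → ℝ} (hf : Γ.IsRational f) :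
    ∃ P : Γ.Divisor, ∀ p, ((P p : ℤ) : ℝ) = Γ.div f p := by
  choose F hF using fun p => hf.exists_int_eq_div p
  choose S hS hS' using fun e => (hf.2 e).exists_finite
  -- The support can only contain vertices and the finitely many breakpoints on each edge.
  have hfin : (Set.range Γ.vertex ∪ ⋃ e, Γ.edgePoint e '' S e).Finite := by
    classical
    exact (Set.finite_range _).union (Set.finite_iUnion fun e => (hS e).image _)
  refine ⟨Finsupp.ofSupportFinite F (hfin.subset fun p hp => ?_), hF⟩
  by_contra hnot
  simp only [Set.mem_union, Set.mem_range, Set.mem_iUnion, not_or, not_exists] at hnot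
  obtain ⟨v, rfl⟩ | ⟨e, t, ht, rfl⟩ := eq_vertex_or_edgePoint p
  · exact hnot.1 v rfl
  obtain ⟨m, c, hmc⟩ := hS' e t ht fun h => hnot.2 e ⟨t, h, rfl⟩
  have h0 := hmc.self_of_nhds
  apply hp
  have h1 : HasSlope f (Γ.edgePoint e t) e m := by
    rw [hasSlope_edgePoint ⟨ht.1.le, ht.2.le⟩]
    exact (hasRightSlope_linear m c t).congr (hmc.filter_mono nhdsWithin_le_nhds) h0
  have h2 : HasSlope f (Γ.edgePoint e t) e.symm (-m) := by
    rw [hasSlope_edgePoint_symm ⟨ht.1, ht.2.le⟩]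
    have : Tendsto (fun ε : ℝ => t - ε) (𝓝[>] 0) (𝓝 t) := by
      have : Tendsto (fun ε : ℝ => t - ε) (𝓝 0) (𝓝 (t - 0)) :=
        (continuous_const.sub continuous_id).tendsto 0
      rw [sub_zero] at this
      exact this.mono_left nhdsWithin_le_nhds
    filter_upwards [this.eventually hmc] with ε hε
    rw [hε, h0]; push_cast; ring
  have := (hF _).trans (div_edgePoint ht h1 h2)
  rw [Int.cast_inj.1 this]; ring

/-! ### Truncated tents on an edge. -/

/-- The height profile of a truncated tent over the interval `[a, b]`. -/
def tentProfile (a b c s : ℝ) : ℝ := min c (min (max 0 (s - a)) (max 0 (b - s)))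

/-- The truncated tent over the part `[a, b]` of the edge `e`. -/
def tent (e : Γ.graph.Dart) (a b c : ℝ) (p : Γ.Point) : ℝ :=
  min c (min (max 0 (Γ.dartLength e * p.1 e.snd - a))
    (max 0 (b - Γ.dartLength e * (1 - p.1 e.fst))))

/-- Reversing the edge exchanges the two sides of the tent, so statements at `b` follow from those
at `a`. -/
lemma tent_symm (e : Γ.graph.Dart) (a b c : ℝ) :
    tent e.symm (Γ.dartLength e - b) (Γ.dartLength e - a) c = tent e a b c := by
  funext p
  unfold tent
  rw [dartLength_symm, min_comm (max _ _)]
  congr 3 <;>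
  · simp only [SimpleGraph.Dart.symm, Prod.fst_swap, Prod.snd_swap]
    ring

lemma tent_edgePoint (e : Γ.graph.Dart) (a b c : ℝ) {s : ℝ}
    (hs : s ∈ Set.Icc 0 (Γ.dartLength e)) :
    tent e a b c (Γ.edgePoint e s) = tentProfile a b c s := by
  have hL := (dartLength_pos e).ne'
  unfold tent tentProfile
  rw [dartLength_mul_edgePoint e hs, edgePoint_apply_fst e hs, sub_sub_cancel,
    mul_div_cancel₀ _ hL]

lemma tentProfile_eq_zero {a b c s : ℝ} (hc : 0 ≤ c) (hs : s ≤ a ∨ b ≤ s) :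
    tentProfile a b c s = 0 := by
  unfold tentProfile
  rcases hs with hs | hs
  · rw [max_eq_left (by linarith : s - a ≤ 0), min_eq_left (le_max_left _ _), min_eq_right hc]
  · rw [max_eq_left (by linarith : b - s ≤ 0), min_eq_right (le_max_left _ _), min_eq_right hc]

lemma tent_eq_zero {e : Γ.graph.Dart} {a b c : ℝ} (ha : 0 ≤ a) (hb : b ≤ Γ.dartLength e)
    (hc : 0 ≤ c) {p : Γ.Point} (hp : p.1 e.fst = 0 ∨ p.1 e.snd = 0) : tent e a b c p = 0 := by
  unfold tent
  rcases hp with hp | hp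
  · rw [hp, max_eq_left (b := b - _) (by linarith), min_eq_right (le_max_left _ _),
      min_eq_right hc]
  · rw [hp, max_eq_left (b := _ - a) (by linarith), min_eq_left (le_max_left _ _),
      min_eq_right hc]

/-- Two edges of a simple graph share at most one end. This makes the globally defined tent, and the
summands of `interpolation`, vanish off their own edge. -/
lemma edgePoint_apply_eq_zero {e e' : Γ.graph.Dart} (h : e' ≠ e) (h' : e' ≠ e.symm) {s : ℝ}
    (hs : s ∈ Set.Icc 0 (Γ.dartLength e')) :
    (Γ.edgePoint e' s).1 e.fst = 0 ∨ (Γ.edgePoint e' s).1 e.snd = 0 := by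
  by_contra! hne
  have h1 : e.fst = e'.fst ∨ e.fst = e'.snd := by
    by_contra! hh; exact hne.1 (edgePoint_apply_of_ne e' hs hh.1 hh.2)
  have h2 : e.snd = e'.fst ∨ e.snd = e'.snd := by
    by_contra! hh; exact hne.2 (edgePoint_apply_of_ne e' hs hh.1 hh.2)
  have hn := e.adj.ne
  rcases h1 with h1 | h1 <;> rcases h2 with h2 | h2
  · exact hn (h1.trans h2.symm)
  · exact h (SimpleGraph.Dart.ext _ _ (Prod.ext h1.symm h2.symm))
  · exact h' (SimpleGraph.Dart.ext _ _ (Prod.ext h2.symm h1.symm))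
  · exact hn (h1.trans h2.symm)

lemma eventually_mem_Icc {e : Γ.graph.Dart} {s : ℝ} (hs : s ∈ Set.Ico 0 (Γ.dartLength e)) :
    ∀ᶠ u in 𝓝[>] s, u ∈ Set.Icc 0 (Γ.dartLength e) := by
  filter_upwards [Ioo_mem_nhdsGT hs.2] with u hu
  exact ⟨hs.1.trans hu.1.le, hu.2.le⟩

lemma exists_hasSlope_tent (e : Γ.graph.Dart) (a b c : ℝ) {p : Γ.Point}
    (hp : e ∈ Γ.directions p) : ∃ m, HasSlope (tent e a b c) p e m := by
  obtain ⟨s, hs, rfl⟩ := hp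
  have hT : ∃ m, HasRightSlope (tentProfile a b c) s m := by
    refine HasRightSlope.exists_min ⟨0, hasRightSlope_const _ _⟩ (HasRightSlope.exists_min
      (HasRightSlope.exists_max ⟨0, hasRightSlope_const _ _⟩ ⟨1, ?_⟩)
      (HasRightSlope.exists_max ⟨0, hasRightSlope_const _ _⟩ ⟨-1, ?_⟩))
    · exact Eventually.of_forall fun u => by push_cast; ring
    · exact Eventually.of_forall fun u => by push_cast; ring
  obtain ⟨m, hm⟩ := hT
  refine ⟨m, (hasSlope_edgePoint ⟨hs.1, hs.2.le⟩).2 (hm.congr ?_ ?_)⟩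
  · filter_upwards [eventually_mem_Icc hs] with u hu using tent_edgePoint e a b c hu
  · exact tent_edgePoint e a b c ⟨hs.1, hs.2.le⟩

lemma hasSlope_zero_of_eventually {f : Γ.Point → ℝ} {e : Γ.graph.Dart} {s : ℝ}
    (hs : s ∈ Set.Ico 0 (Γ.dartLength e)) (h0 : f (Γ.edgePoint e s) = 0)
    (h : ∀ᶠ u in 𝓝[>] s, f (Γ.edgePoint e u) = 0) : HasSlope f (Γ.edgePoint e s) e 0 :=
  (hasSlope_edgePoint ⟨hs.1, hs.2.le⟩).2 ((hasRightSlope_const 0 s).congr h h0)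

lemma hasSlope_tent_of_ne {e e' : Γ.graph.Dart} {a b c : ℝ} (ha : 0 ≤ a)
    (hb : b ≤ Γ.dartLength e) (hc : 0 ≤ c) {p : Γ.Point} (hp : e' ∈ Γ.directions p)
    (h : e' ≠ e) (h' : e' ≠ e.symm) : HasSlope (tent e a b c) p e' 0 := by
  obtain ⟨s, hs, rfl⟩ := hp
  refine hasSlope_zero_of_eventually hs
    (tent_eq_zero ha hb hc (edgePoint_apply_eq_zero h h' ⟨hs.1, hs.2.le⟩)) ?_
  filter_upwards [eventually_mem_Icc hs] with u hu
  exact tent_eq_zero ha hb hc (edgePoint_apply_eq_zero h h' hu)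

lemma isRational_tent {e : Γ.graph.Dart} {a b c : ℝ} (ha : 0 ≤ a)
    (hb : b ≤ Γ.dartLength e) (hc : 0 ≤ c) : Γ.IsRational (tent e a b c) := by
  refine isRational_iff.2 ⟨?_, fun p e' he' => ?_⟩
  · have (v : V) : Continuous fun p : Γ.Point => p.1 v :=
      (continuous_apply v).comp continuous_subtype_val
    have h1 := this e.fst
    have h2 := this e.snd
    exact continuous_const.min ((continuous_const.max ((h2.const_mul _).sub continuous_const)).min
      (continuous_const.max (continuous_const.sub ((continuous_const.sub h1).const_mul _))))
  · by_cases h : e' = e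
    · subst h; exact exists_hasSlope_tent _ _ _ _ he'
    by_cases h' : e' = e.symm
    · subst h'
      rw [← tent_symm]
      exact exists_hasSlope_tent _ _ _ _ he'
    · exact ⟨0, hasSlope_tent_of_ne ha hb hc he' h h'⟩

lemma hasSlope_tent_self {e : Γ.graph.Dart} {a b c : ℝ} (hc : 0 < c) {p : Γ.Point}
    (hp : e ∈ Γ.directions p) (h0 : tent e a b c p = 0) (hpa : p ≠ Γ.edgePoint e a) :
    HasSlope (tent e a b c) p e 0 := by
  obtain ⟨s, hs, rfl⟩ := hp
  have hsa : s ≠ a := fun h => hpa (by rw [h])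
  have hsI : s ∈ Set.Icc 0 (Γ.dartLength e) := ⟨hs.1, hs.2.le⟩
  have hcase : s < a ∨ b ≤ s := by
    by_contra! hh
    rw [tent_edgePoint e a b c hsI] at h0
    have : 0 < tentProfile a b c s :=
      lt_min hc (lt_min (lt_max_of_lt_right (sub_pos.2 (lt_of_le_of_ne hh.1 hsa.symm)))
        (lt_max_of_lt_right (sub_pos.2 hh.2)))
    linarith
  refine hasSlope_zero_of_eventually hs h0 ?_
  rcases hcase with h | h
  · filter_upwards [eventually_mem_Icc hs, Ioo_mem_nhdsGT h] with u hu hu'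
    rw [tent_edgePoint e a b c hu, tentProfile_eq_zero hc.le (Or.inl hu'.2.le)]
  · filter_upwards [eventually_mem_Icc hs, self_mem_nhdsWithin] with u hu hu'
    rw [tent_edgePoint e a b c hu, tentProfile_eq_zero hc.le (Or.inr (h.trans (le_of_lt hu')))]

lemma hasSlope_tent_of_eq_zero {e e' : Γ.graph.Dart} {a b c : ℝ} (ha : 0 ≤ a) (hab : a ≤ b)
    (hb : b ≤ Γ.dartLength e) (hc : 0 < c) {p : Γ.Point} (hp : e' ∈ Γ.directions p)
    (h0 : tent e a b c p = 0) (h : e' = e → p ≠ Γ.edgePoint e a)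
    (h' : e' = e.symm → p ≠ Γ.edgePoint e b) : HasSlope (tent e a b c) p e' 0 := by
  by_cases he : e' = e
  · subst he; exact hasSlope_tent_self hc hp h0 (h rfl)
  by_cases he' : e' = e.symm
  · subst he'
    rw [← tent_symm] at h0 ⊢
    refine hasSlope_tent_self hc hp h0 ?_
    rw [edgePoint_symm e ⟨ha.trans hab, hb⟩]
    exact h' rfl
  · exact hasSlope_tent_of_ne ha hb hc.le hp he he'

lemma div_tent_left {e : Γ.graph.Dart} {a b c : ℝ} (ha : 0 ≤ a) (hab : a < b)
    (hb : b ≤ Γ.dartLength e) (hc : 0 < c) :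
    Γ.div (tent e a b c) (Γ.edgePoint e a) = -1 := by
  classical
  have haI : a ∈ Set.Icc 0 (Γ.dartLength e) := ⟨ha, hab.le.trans hb⟩
  have h0 : tent e a b c (Γ.edgePoint e a) = 0 := by
    rw [tent_edgePoint e a b c haI, tentProfile_eq_zero hc.le (Or.inl le_rfl)]
  have hmem := mem_directions_edgePoint e ⟨ha, hab.trans_le hb⟩
  have hsl : ∀ e' ∈ Γ.directions (Γ.edgePoint e a),
      HasSlope (tent e a b c) (Γ.edgePoint e a) e' (if e' = e then 1 else 0) := by
    intro e' he'
    split_ifs with h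
    · subst h
      refine (hasSlope_edgePoint haI).2 ?_
      unfold HasRightSlope
      filter_upwards [eventually_mem_Icc ⟨ha, hab.trans_le hb⟩,
        -- Below `a + c` the cap is inactive, and below the midpoint the rising side is the lower
        -- one.
        Ioo_mem_nhdsGT (show a < min (a + c) ((a + b) / 2) from
          lt_min (by linarith) (by linarith))] with u hu hu'
      rw [h0, tent_edgePoint _ a b c hu]
      obtain ⟨h1, h2⟩ := hu'
      rw [lt_min_iff] at h2
      unfold tentProfile
      rw [max_eq_right (by linarith : 0 ≤ u - a), max_eq_right (by linarith : 0 ≤ b - u),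
        min_eq_left (by linarith : u - a ≤ b - u), min_eq_right (by linarith)]
      push_cast; ring
    · refine hasSlope_tent_of_eq_zero ha hab.le hb hc he' h0 (fun h' => absurd h' h) fun _ hne => ?_
      have := congrArg (fun p : Γ.Point => Γ.dartLength e * p.1 e.snd) hne
      simp only [dartLength_mul_edgePoint e haI,
        dartLength_mul_edgePoint e ⟨ha.trans hab.le, hb⟩] at this
      exact hab.ne this
  rw [div_eq hsl]
  have : ∑ e' : Γ.graph.Dart with e' ∈ Γ.directions (Γ.edgePoint e a),
      -(if e' = e then (1 : ℤ) else 0) = -1 := by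
    rw [Finset.sum_neg_distrib, Finset.sum_ite_eq', if_pos (by simpa using hmem)]
  rw [show ((-1 : ℝ)) = ((-1 : ℤ) : ℝ) by norm_num, Int.cast_inj]
  convert this

lemma div_tent_right {e : Γ.graph.Dart} {a b c : ℝ} (ha : 0 ≤ a) (hab : a < b)
    (hb : b ≤ Γ.dartLength e) (hc : 0 < c) :
    Γ.div (tent e a b c) (Γ.edgePoint e b) = -1 := by
  rw [← tent_symm, ← edgePoint_symm e ⟨ha.trans hab.le, hb⟩]
  exact div_tent_left (by linarith) (by linarith) (by rw [dartLength_symm]; linarith) hc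

lemma div_tent_edge_nonneg {e : Γ.graph.Dart} {a b c : ℝ} (ha : 0 ≤ a)
    (hb : b ≤ Γ.dartLength e) (hc : 0 ≤ c) {s : ℝ} (hs : s ∈ Set.Ioo 0 (Γ.dartLength e))
    (hsa : s ≠ a) (hsb : s ≠ b) : 0 ≤ Γ.div (tent e a b c) (Γ.edgePoint e s) := by
  refine (isRational_tent ha hb hc).div_edgePoint_nonneg hs ?_
  have hpos : 0 < min s (Γ.dartLength e - s) := lt_min hs.1 (sub_pos.2 hs.2)
  have hI : ∀ ε ∈ Set.Ioo 0 (min s (Γ.dartLength e - s)), s + ε ∈ Set.Icc 0 (Γ.dartLength e) ∧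
      s - ε ∈ Set.Icc 0 (Γ.dartLength e) := by
    rintro ε ⟨h1, h2⟩
    rw [lt_min_iff] at h2
    refine ⟨⟨?_, ?_⟩, ⟨?_, ?_⟩⟩ <;> linarith [hs.1, hs.2]
  rw [tent_edgePoint e a b c ⟨hs.1.le, hs.2.le⟩]
  rcases lt_or_gt_of_ne hsa with h | h
  · filter_upwards [Ioo_mem_nhdsGT hpos, Ioo_mem_nhdsGT (sub_pos.2 h)] with ε h1 h2
    rw [tent_edgePoint e a b c (hI ε h1).1, tent_edgePoint e a b c (hI ε h1).2,
      tentProfile_eq_zero hc (Or.inl (by linarith [h2.2])),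
      tentProfile_eq_zero hc (Or.inl (by linarith [h2.1])),
      tentProfile_eq_zero hc (Or.inl h.le)]
    norm_num
  rcases lt_or_gt_of_ne hsb with h' | h'
  · filter_upwards [Ioo_mem_nhdsGT hpos, Ioo_mem_nhdsGT (sub_pos.2 h),
      Ioo_mem_nhdsGT (sub_pos.2 h')] with ε h1 h2 h3
    rw [tent_edgePoint e a b c (hI ε h1).1, tent_edgePoint e a b c (hI ε h1).2]
    obtain ⟨h2, h4⟩ := h2
    have h5 := h3.2
    -- Between `a` and `b` the tent is a minimum of affine functions: the one attaining the minimum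
    -- at `s` bounds the values at `s ± ε`, which gives midpoint concavity.
    have hT : ∀ u, a ≤ u → u ≤ b → tentProfile a b c u = min c (min (u - a) (b - u)) := by
      intro u hu hu'
      unfold tentProfile
      rw [max_eq_right (sub_nonneg.2 hu), max_eq_right (sub_nonneg.2 hu')]
    rw [hT s h.le h'.le, hT _ (by linarith) (by linarith), hT _ (by linarith) (by linarith)]
    have k1 := min_le_left c (min (s + ε - a) (b - (s + ε)))
    have k2 := (min_le_right c (min (s + ε - a) (b - (s + ε)))).trans (min_le_left _ _)
    have k3 := (min_le_right c (min (s + ε - a) (b - (s + ε)))).trans (min_le_right _ _)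
    have k4 := min_le_left c (min (s - ε - a) (b - (s - ε)))
    have k5 := (min_le_right c (min (s - ε - a) (b - (s - ε)))).trans (min_le_left _ _)
    have k6 := (min_le_right c (min (s - ε - a) (b - (s - ε)))).trans (min_le_right _ _)
    rcases min_choice c (min (s - a) (b - s)) with h | h <;> rw [h]
    · linarith
    rcases min_choice (s - a) (b - s) with h | h <;> rw [h] <;> linarith
  · filter_upwards [Ioo_mem_nhdsGT hpos, Ioo_mem_nhdsGT (sub_pos.2 h')] with ε h1 h2
    rw [tent_edgePoint e a b c (hI ε h1).1, tent_edgePoint e a b c (hI ε h1).2,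
      tentProfile_eq_zero hc (Or.inr (by linarith [h2.1])),
      tentProfile_eq_zero hc (Or.inr (by linarith [h2.2])),
      tentProfile_eq_zero hc (Or.inr h'.le)]
    norm_num

lemma div_tent_nonneg {e : Γ.graph.Dart} {a b c : ℝ} (ha : 0 ≤ a) (hab : a < b)
    (hb : b ≤ Γ.dartLength e) (hc : 0 < c) {p : Γ.Point} (hpa : p ≠ Γ.edgePoint e a)
    (hpb : p ≠ Γ.edgePoint e b) : 0 ≤ Γ.div (tent e a b c) p := by
  obtain ⟨v, rfl⟩ | ⟨e', s, hs, rfl⟩ := eq_vertex_or_edgePoint p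
  · have h0 : tent e a b c (Γ.vertex v) = 0 := by
      refine tent_eq_zero ha hb hc.le ?_
      by_contra! h
      have h1 : e.fst = v := by
        by_contra hne; exact h.1 (by simp [vertex, hne])
      have h2 : e.snd = v := by
        by_contra hne; exact h.2 (by simp [vertex, hne])
      exact e.adj.ne (h1.trans h2.symm)
    rw [div_eq (m := 0) fun e' he' =>
      hasSlope_tent_of_eq_zero ha hab.le hb hc he' h0 (fun _ => hpa) (fun _ => hpb)]
    simp
  by_cases h : e' = e
  · subst h
    exact div_tent_edge_nonneg ha hb hc.le hs (fun h => hpa (by rw [h])) fun h => hpb (by rw [h])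
  by_cases h' : e' = e.symm
  · subst h'
    rw [← tent_symm]
    refine div_tent_edge_nonneg (by linarith) (by rw [dartLength_symm]; linarith) hc.le hs
      (fun h => hpb ?_) fun h => hpa ?_
    · rw [h, edgePoint_symm e ⟨ha.trans hab.le, hb⟩]
    · rw [h, edgePoint_symm e ⟨ha, hab.le.trans hb⟩]
  · rw [div_edgePoint hs
      (hasSlope_tent_of_ne ha hb hc.le (mem_directions_edgePoint e' ⟨hs.1.le, hs.2⟩) h h')
      (hasSlope_tent_of_ne ha hb hc.le (symm_mem_directions_edgePoint e' ⟨hs.1, hs.2.le⟩)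
        (fun hh => h' (by rw [← hh, SimpleGraph.Dart.symm_symm]))
        (fun hh => h (by rw [← SimpleGraph.Dart.symm_symm e', hh, SimpleGraph.Dart.symm_symm])))]
    simp

/-- With this cap, `t` is an end of the plateau (or the peak), so the tent is strictly concave
there. -/
lemma one_le_div_tent {e : Γ.graph.Dart} {a b t : ℝ} (ha : 0 ≤ a) (hat : a < t) (htb : t < b)
    (hb : b ≤ Γ.dartLength e) :
    1 ≤ Γ.div (tent e a b (min (t - a) (b - t))) (Γ.edgePoint e t) := by
  have hc : 0 < min (t - a) (b - t) := lt_min (sub_pos.2 hat) (sub_pos.2 htb)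
  have ht : t ∈ Set.Ioo 0 (Γ.dartLength e) := ⟨ha.trans_lt hat, htb.trans_le hb⟩
  refine (isRational_tent ha hb hc.le).one_le_div_edgePoint ht ?_
  filter_upwards [Ioo_mem_nhdsGT hc] with ε hε
  obtain ⟨h1, h2⟩ := hε
  obtain ⟨h3, h4⟩ := lt_min_iff.1 h2
  rw [tent_edgePoint _ _ _ _ ⟨ht.1.le, ht.2.le⟩,
    tent_edgePoint _ _ _ _ ⟨by linarith, by linarith⟩,
    tent_edgePoint _ _ _ _ ⟨by linarith, by linarith⟩]
  have hT : ∀ u, a ≤ u → u ≤ b → tentProfile a b (min (t - a) (b - t)) u =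
      min (min (t - a) (b - t)) (min (u - a) (b - u)) := by
    intro u hu hu'
    unfold tentProfile
    rw [max_eq_right (sub_nonneg.2 hu), max_eq_right (sub_nonneg.2 hu')]
  rw [hT _ (by linarith) (by linarith), hT _ (by linarith) (by linarith),
    hT t hat.le htb.le, min_self]
  set c := min (t - a) (b - t) with hcdef
  have k1 := min_le_left c (min (t + ε - a) (b - (t + ε)))
  have k3 := (min_le_right c (min (t + ε - a) (b - (t + ε)))).trans (min_le_right _ _)
  have k4 := min_le_left c (min (t - ε - a) (b - (t - ε)))
  have k5 := (min_le_right c (min (t - ε - a) (b - (t - ε)))).trans (min_le_left _ _)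
  rcases min_choice (t - a) (b - t) with h | h <;> rw [← hcdef] at h <;> linarith

/-! ### Linear equivalence and linear systems. -/

lemma LinearlyEquivalent.refl (D : Γ.Divisor) : Γ.LinearlyEquivalent D D :=
  ⟨fun _ => 0, isRational_const 0, fun p => by simp [div_const]⟩

lemma LinearlyEquivalent.symm {D E : Γ.Divisor} (h : Γ.LinearlyEquivalent D E) :
    Γ.LinearlyEquivalent E D := by
  obtain ⟨f, hf, h⟩ := h
  refine ⟨_, hf.neg, fun p => ?_⟩
  rw [div_neg hf, ← h p]
  simp

lemma LinearlyEquivalent.trans {D E F : Γ.Divisor} (h : Γ.LinearlyEquivalent D E)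
    (h' : Γ.LinearlyEquivalent E F) : Γ.LinearlyEquivalent D F := by
  obtain ⟨f, hf, h⟩ := h
  obtain ⟨g, hg, h'⟩ := h'
  refine ⟨_, hf.add hg, fun p => ?_⟩
  rw [div_add hf hg, ← h p, ← h' p]
  simp

lemma LinearlyEquivalent.sub_right {D E : Γ.Divisor} (h : Γ.LinearlyEquivalent D E)
    (F : Γ.Divisor) : Γ.LinearlyEquivalent (D - F) (E - F) := by
  obtain ⟨f, hf, h⟩ := h
  exact ⟨f, hf, fun p => by rw [← h p]; simp⟩

lemma LinearlyEquivalent.add_right {D E : Γ.Divisor} (h : Γ.LinearlyEquivalent D E)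
    (F : Γ.Divisor) : Γ.LinearlyEquivalent (D + F) (E + F) := by
  obtain ⟨f, hf, h⟩ := h
  exact ⟨f, hf, fun p => by rw [← h p]; simp⟩

lemma exists_mem_linearSystem {D : Γ.Divisor} {f : Γ.Point → ℝ} (hf : Γ.IsRational f)
    (h : ∀ p, 0 ≤ (D p : ℝ) + Γ.div f p) :
    ∃ D' ∈ Γ.linearSystem D, ∀ p, ((D' p : ℤ) : ℝ) = D p + Γ.div f p := by
  obtain ⟨P, hP⟩ := hf.exists_divisor
  refine ⟨D + P, ⟨fun p => ?_, f, hf, fun p => ?_⟩, fun p => ?_⟩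
  · have := h p
    rw [← hP p] at this
    exact_mod_cast this
  · rw [← hP p]; simp
  · rw [← hP p]; simp

/-! ### From chips at the vertices to a chip at any point. -/

/-- If `f` is at least the cut-off value at the initial vertex, truncation costs that vertex nothing
and its chip stays. Otherwise `f` first reaches the cut-off somewhere in `(0, t]`, and the truncated
function has a kink there that deposits a chip. -/
lemma exists_chip_of_chip_fst {D₁ D₃ : Γ.Divisor} (h₁ : 0 ≤ D₁) {f : Γ.Point → ℝ}
    (hf : Γ.IsRational f) {e : Γ.graph.Dart} {t : ℝ} (ht : t ∈ Set.Icc 0 (Γ.dartLength e))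
    (h₃ : ∀ p, ((D₃ p : ℤ) : ℝ) =
      D₁ p + Γ.div (fun q => min (f q) (f (Γ.edgePoint e t))) p)
    (hv : 1 ≤ D₁ (Γ.vertex e.fst)) : ∃ s ∈ Set.Icc 0 t, 1 ≤ D₃ (Γ.edgePoint e s) := by
  set c := f (Γ.edgePoint e t) with hc
  rcases le_or_gt c (f (Γ.vertex e.fst)) with h | h
  · refine ⟨0, ⟨le_rfl, ht.1⟩, ?_⟩
    rw [edgePoint_zero]
    have h0 := div_nonneg_min_const hf h
    have : ((1 : ℤ) : ℝ) ≤ D₃ (Γ.vertex e.fst) := by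
      rw [h₃]
      have : ((1 : ℤ) : ℝ) ≤ D₁ (Γ.vertex e.fst) := Int.cast_le.2 hv
      linarith
    exact Int.cast_le.1 this
  · have hcont : Continuous fun s => f (Γ.edgePoint e s) := hf.1.comp (continuous_edgePoint e)
    have hcomp : IsCompact (Set.Icc 0 t ∩ {s | c ≤ f (Γ.edgePoint e s)}) :=
      isCompact_Icc.inter_right (isClosed_le continuous_const hcont)
    obtain ⟨q, ⟨hq, hqc⟩, hmin⟩ := hcomp.exists_isLeast ⟨t, ⟨ht.1, le_rfl⟩, hc.le⟩
    have hq0 : 0 < q := by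
      refine lt_of_le_of_ne hq.1 ?_
      rintro rfl
      rw [Set.mem_ofPred_eq, edgePoint_zero] at hqc
      exact absurd h (not_lt.2 hqc)
    have hlt : ∀ s ∈ Set.Ico 0 q, f (Γ.edgePoint e s) < c := by
      intro s hs
      by_contra! hle
      exact absurd (hmin ⟨⟨hs.1, hs.2.le.trans hq.2⟩, hle⟩) (not_le.2 hs.2)
    have hqeq : f (Γ.edgePoint e q) = c := by
      refine le_antisymm (le_of_tendsto (hcont.continuousAt.mono_left
        (nhdsWithin_le_nhds (s := Set.Iio q))) ?_) hqc
      filter_upwards [Ioo_mem_nhdsLT hq0] with s hs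
      exact (hlt s ⟨hs.1.le, hs.2⟩).le
    have hqL : q ∈ Set.Ioc 0 (Γ.dartLength e) := ⟨hq0, hq.2.trans ht.2⟩
    have hmem := symm_mem_directions_edgePoint e hqL
    obtain ⟨k, hk⟩ := (isRational_iff.1 hf).2 _ _ hmem
    -- Just before its first hitting point `q`, `f` is below `c`, so it decreases in the backward
    -- direction.
    have hk0 : k < 0 := by
      obtain ⟨ε, h1, h2⟩ := (((hasSlope_edgePoint_symm hqL).1 hk).and
        (Ioo_mem_nhdsGT hq0)).exists
      have h3 := hlt (q - ε) ⟨by linarith [h2.2], by linarith [h2.1]⟩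
      rw [h1, hqeq] at h3
      by_contra! hk0
      have : (0 : ℝ) ≤ k := by exact_mod_cast hk0
      linarith [mul_nonneg this h2.1.le]
    refine ⟨q, hq, ?_⟩
    have h0 := one_le_div_min_const hf hqeq hmem hk hk0
    have h4 : (0 : ℝ) ≤ D₁ (Γ.edgePoint e q) := by exact_mod_cast h₁ (Γ.edgePoint e q)
    have : ((1 : ℤ) : ℝ) ≤ D₃ (Γ.edgePoint e q) := by
      rw [h₃]; push_cast; linarith
    exact Int.cast_le.1 this

/-- The two chips move towards each other at equal speed until the nearer one reaches `t`; the tent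
capped at height `min (t - a) (b - t)` does this. -/
lemma exists_chip_of_chips_on_edge {D : Γ.Divisor} (hD : 0 ≤ D) {e : Γ.graph.Dart} {a b t : ℝ}
    (ha : 0 ≤ a) (hat : a ≤ t) (htb : t ≤ b) (hb : b ≤ Γ.dartLength e)
    (hDa : 1 ≤ D (Γ.edgePoint e a)) (hDb : 1 ≤ D (Γ.edgePoint e b)) :
    ∃ D' ∈ Γ.linearSystem D, 1 ≤ D' (Γ.edgePoint e t) := by
  rcases hat.eq_or_lt with rfl | hat
  · exact ⟨D, ⟨hD, .refl D⟩, hDa⟩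
  rcases htb.eq_or_lt with rfl | htb
  · exact ⟨D, ⟨hD, .refl D⟩, hDb⟩
  have hab := hat.trans htb
  have hc : 0 < min (t - a) (b - t) := lt_min (sub_pos.2 hat) (sub_pos.2 htb)
  have hnn : ∀ p, (0 : ℝ) ≤ D p := fun p => by exact_mod_cast hD p
  obtain ⟨D', hD', h⟩ := exists_mem_linearSystem (D := D) (isRational_tent ha hb hc.le) fun p => by
    by_cases hpa : p = Γ.edgePoint e a
    · rw [hpa, div_tent_left ha hab hb hc]
      have : (1 : ℝ) ≤ D (Γ.edgePoint e a) := by exact_mod_cast hDa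
      linarith
    by_cases hpb : p = Γ.edgePoint e b
    · rw [hpb, div_tent_right ha hab hb hc]
      have : (1 : ℝ) ≤ D (Γ.edgePoint e b) := by exact_mod_cast hDb
      linarith
    · have := div_tent_nonneg ha hab hb hc hpa hpb
      linarith [hnn p]
  refine ⟨D', hD', ?_⟩
  have : ((1 : ℤ) : ℝ) ≤ D' (Γ.edgePoint e t) := by
    rw [h]
    have := one_le_div_tent ha hat htb hb
    push_cast
    linarith [hnn (Γ.edgePoint e t)]
  exact Int.cast_le.1 this

/-- If every vertex lies in the support of a member of `|D|`, then so does every point. -/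
lemma exists_chip_of_forall_vertex {D : Γ.Divisor}
    (h : ∀ v, ∃ D' ∈ Γ.linearSystem D, 1 ≤ D' (Γ.vertex v)) (p : Γ.Point) :
    ∃ D' ∈ Γ.linearSystem D, 1 ≤ D' p := by
  obtain ⟨v, rfl⟩ | ⟨e, t, ht, rfl⟩ := eq_vertex_or_edgePoint p
  · exact h v
  obtain ⟨D₁, ⟨h₁, hE₁⟩, hv₁⟩ := h e.fst
  obtain ⟨D₂, ⟨h₂, hE₂⟩, hv₂⟩ := h e.snd
  obtain ⟨f, hf, hdiv⟩ := hE₂.trans hE₁.symm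
  have hD₂ : ∀ p, (D₂ p : ℝ) = D₁ p + Γ.div f p := fun p => by
    rw [← hdiv p]; simp
  have htI : t ∈ Set.Icc 0 (Γ.dartLength e) := ⟨ht.1.le, ht.2.le⟩
  set c := f (Γ.edgePoint e t) with hc
  -- Where `f ≥ c` the new divisor dominates `D₁`, and where `f ≤ c` it dominates `D₂`, so it is
  -- effective.
  obtain ⟨D₃, ⟨h₃, hE₃⟩, hdiv₃⟩ :=
      exists_mem_linearSystem (D := D₁) (hf.min (isRational_const c)) fun p => by
    rcases le_total c (f p) with hle | hle
    · have := div_nonneg_min_const hf hle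
      have : (0 : ℝ) ≤ D₁ p := by exact_mod_cast h₁ p
      linarith
    · have := div_le_div_min_const hf hle
      have h2 : (0 : ℝ) ≤ D₂ p := by exact_mod_cast h₂ p
      rw [hD₂] at h2
      linarith
  obtain ⟨a, ha, hDa⟩ := exists_chip_of_chip_fst h₁ hf htI hdiv₃ hv₁
  have htI' : Γ.dartLength e - t ∈ Set.Icc 0 (Γ.dartLength e.symm) := by
    rw [dartLength_symm]; constructor <;> linarith [ht.1, ht.2]
  have hpt : Γ.edgePoint e.symm (Γ.dartLength e - t) = Γ.edgePoint e t := edgePoint_symm e htI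
  -- Seen from `D₂`, the same `D₃` is the truncation of `-f` at `-c`, because `min (-f) (-c) = min f
  -- c - f - c`. Applying the lemma to the reversed edge gives a chip on the other side of `t`.
  obtain ⟨b, hb, hDb⟩ := exists_chip_of_chip_fst (D₃ := D₃) h₂ hf.neg htI' (fun p => by
    rw [hdiv₃, hD₂, hpt, ← hc]
    have hfun : (fun q => min (-f q) (-c)) = fun q => (min (f q) c + -f q) + (-c) := by
      funext q
      rw [min_neg_neg]
      linarith [min_add_max (f q) c]
    rw [hfun, div_add ((hf.min (isRational_const c)).add hf.neg) (isRational_const _),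
      div_add (hf.min (isRational_const c)) hf.neg, div_neg hf, div_const]
    ring) hv₂
  have hbI : b ∈ Set.Icc 0 (Γ.dartLength e) := ⟨hb.1, by linarith [hb.2, ht.1]⟩
  rw [edgePoint_symm_apply e hbI] at hDb
  obtain ⟨D', ⟨hD', hE'⟩, h1⟩ := exists_chip_of_chips_on_edge h₃ ha.1 ha.2
    (by linarith [hb.2]) (by linarith [hb.1]) hDa hDb
  exact ⟨D', ⟨hD', hE'.trans (hE₃.trans hE₁)⟩, h1⟩

lemma linearSystem_sub_single_nonempty_iff {D : Γ.Divisor} {p : Γ.Point} :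
    (Γ.linearSystem (D - Finsupp.single p 1)).Nonempty ↔
      ∃ D' ∈ Γ.linearSystem D, 1 ≤ D' p := by
  constructor
  · rintro ⟨F, hF, hE⟩
    refine ⟨F + Finsupp.single p 1, ⟨add_nonneg hF (Finsupp.single_nonneg.2 zero_le_one), ?_⟩, ?_⟩
    · have := hE.add_right (Finsupp.single p 1)
      rwa [sub_add_cancel] at this
    · have := hF p
      simp only [Finsupp.coe_zero, Pi.zero_apply] at this
      simp [this]
  · rintro ⟨F, ⟨hF, hE⟩, h⟩
    refine ⟨F - Finsupp.single p 1, fun q => ?_, hE.sub_right _⟩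
    have := hF q
    by_cases hq : p = q
    · subst hq; simp [h]
    · simpa [Finsupp.single_apply, hq] using this

/-! ### Divisors on the vertices, and the reduction of the rank to them. -/

/-- The divisor supported on the vertices with coefficients `b`. -/
noncomputable def vertexDivisor (Γ : MetricGraph V) (b : V → ℤ) : Γ.Divisor :=
  ∑ v, Finsupp.single (Γ.vertex v) (b v)

lemma vertexDivisor_vertex (b : V → ℤ) (v : V) : Γ.vertexDivisor b (Γ.vertex v) = b v := by
  unfold vertexDivisor
  rw [Finsupp.finsetSum_apply, Finset.sum_eq_single v]
  · simp
  · intro w _ hw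
    exact Finsupp.single_eq_of_ne fun h => hw (vertex_injective h).symm
  · simp

lemma vertexDivisor_of_ne (b : V → ℤ) {p : Γ.Point} (hp : ∀ v, p ≠ Γ.vertex v) :
    Γ.vertexDivisor b p = 0 := by
  unfold vertexDivisor
  rw [Finsupp.finsetSum_apply]
  exact Finset.sum_eq_zero fun v _ => Finsupp.single_eq_of_ne (hp v)

lemma vertexDivisor_sub (b b' : V → ℤ) :
    Γ.vertexDivisor (b - b') = Γ.vertexDivisor b - Γ.vertexDivisor b' := by
  simp [vertexDivisor, Finset.sum_sub_distrib]

lemma vertexDivisor_add_single (b : V → ℤ) (v : V) :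
    Γ.vertexDivisor (b + Pi.single v 1) = Γ.vertexDivisor b + Finsupp.single (Γ.vertex v) 1 := by
  simp only [vertexDivisor, Pi.add_apply, Finsupp.single_add, Finset.sum_add_distrib]
  congr 1
  rw [Finset.sum_eq_single v]
  · simp
  · intro w _ hw; simp [hw]
  · simp

lemma vertexDivisor_nonneg {b : V → ℤ} (hb : 0 ≤ b) : 0 ≤ Γ.vertexDivisor b :=
  Finset.sum_nonneg fun v _ => Finsupp.single_nonneg.2 (hb v)

lemma degree_add (D E : Γ.Divisor) : Γ.degree (D + E) = Γ.degree D + Γ.degree E :=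
  Finsupp.sum_add_index' (fun _ => rfl) fun _ _ _ => rfl

lemma degree_single (p : Γ.Point) (n : ℤ) : Γ.degree (Finsupp.single p n) = n :=
  Finsupp.sum_single_index rfl

lemma degree_vertexDivisor (b : V → ℤ) : Γ.degree (Γ.vertexDivisor b) = ∑ v, b v := by
  let φ : Γ.Divisor →+ ℤ := ⟨⟨Γ.degree, Finsupp.sum_zero_index⟩, degree_add⟩
  change φ _ = _
  rw [vertexDivisor, map_sum]
  exact Finset.sum_congr rfl fun v _ => degree_single _ _

/-- The vertices form a rank-determining set. -/
lemma linearSystem_sub_nonempty_of_vertices (r : ℕ) : ∀ D : Γ.Divisor,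
    (∀ a : V → ℤ, 0 ≤ a → ∑ v, a v = r →
      (Γ.linearSystem (D - Γ.vertexDivisor a)).Nonempty) →
    ∀ E : Γ.Divisor, 0 ≤ E → Γ.degree E = r → (Γ.linearSystem (D - E)).Nonempty := by
  induction r with
  | zero =>
    intro D h E hE hdeg
    have hE0 : E = 0 := by
      have := (Finset.sum_eq_zero_iff_of_nonneg fun p _ => hE p).1 hdeg
      ext p
      by_cases hp : p ∈ E.support
      · exact this p hp
      · simpa using hp
    have := h 0 le_rfl (by simp)
    rwa [hE0, sub_zero, ← sub_zero D, show (0 : Γ.Divisor) = Γ.vertexDivisor 0 by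
      simp [vertexDivisor]]
  | succ r ih =>
    intro D h E hE hdeg
    have hne : E ≠ 0 := by
      rintro rfl
      simp only [degree, Finsupp.sum_zero_index] at hdeg
      norm_cast at hdeg
    obtain ⟨p, hp⟩ := Finsupp.ne_iff.1 hne
    have hp1 : 1 ≤ E p := by
      have := hE p
      simp only [Finsupp.coe_zero, Pi.zero_apply] at this hp
      omega
    have hE' : 0 ≤ E - Finsupp.single p 1 := by
      intro q
      have := hE q
      by_cases hq : p = q
      · subst hq; simp [hp1]
      · simpa [Finsupp.single_apply, hq] using this
    have hdeg' : Γ.degree (E - Finsupp.single p 1) = r := by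
      have := degree_add (E - Finsupp.single p 1) (Finsupp.single p 1)
      rw [sub_add_cancel, degree_single, hdeg] at this
      push_cast at this
      linarith
    -- One point `p` of `E` is split off into the divisor, which is why the induction is over all
    -- `D`. For vertex divisors `a` of degree `r`, the point `p` is then reached in the system of `D
    -- - a`, where every vertex is reached by hypothesis.
    have key := ih (D - Finsupp.single p 1) (fun a ha hsum => ?_) _ hE' hdeg'
    · rwa [sub_sub_sub_cancel_right] at key
    rw [sub_right_comm, linearSystem_sub_single_nonempty_iff]
    refine exists_chip_of_forall_vertex (fun v => ?_) p
    rw [← linearSystem_sub_single_nonempty_iff, sub_sub, ← vertexDivisor_add_single]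
    refine h _ (add_nonneg ha ?_) ?_
    · intro w
      by_cases hw : w = v
      · subst hw; simp
      · simp [hw]
    · simp [Finset.sum_add_distrib, hsum]

/-! ### Extending vertex potentials to rational functions. -/

lemma edgePoint_apply_nonneg (e : Γ.graph.Dart) {t : ℝ} (ht : t ∈ Set.Icc 0 (Γ.dartLength e))
    (v : V) : 0 ≤ (Γ.edgePoint e t).1 v := by
  have h0 := div_nonneg ht.1 (dartLength_pos e).le
  have h1 : t / Γ.dartLength e ≤ 1 := (div_le_one (dartLength_pos e)).2 ht.2
  rw [edgePoint_apply e ht]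
  refine add_nonneg (mul_nonneg (sub_nonneg.2 h1) ?_) (mul_nonneg h0 ?_) <;>
  split_ifs <;> norm_num

/-- The average slope along `e` of a function with values `y` at the vertices. -/
noncomputable def avgSlope (y : V → ℝ) (e : Γ.graph.Dart) : ℝ :=
  (y e.snd - y e.fst) / Γ.dartLength e

lemma avgSlope_symm (y : V → ℝ) (e : Γ.graph.Dart) : avgSlope y e.symm = -avgSlope y e := by
  unfold avgSlope
  rw [dartLength_symm, ← neg_div, neg_sub]
  rfl

/-- The rise over `e` needed to round the average slope up to an integer. -/
noncomputable def slopeDefect (y : V → ℝ) (e : Γ.graph.Dart) : ℝ :=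
  Γ.dartLength e * (⌈avgSlope y e⌉ - avgSlope y e)

lemma slopeDefect_nonneg (y : V → ℝ) (e : Γ.graph.Dart) : 0 ≤ slopeDefect y e :=
  mul_nonneg (dartLength_pos e).le (sub_nonneg.2 (Int.le_ceil _))

open Classical in
/-- The rational function with values `y` at the vertices that is concave with at most one
interior chip position along each edge. -/
noncomputable def interpolation (Γ : MetricGraph V) (y : V → ℝ) (p : Γ.Point) : ℝ :=
  ∑ v, y v * p.1 v + 2⁻¹ * ∑ e : Γ.graph.Dart,
    min (slopeDefect y e * p.1 e.snd) (slopeDefect y e.symm * p.1 e.fst)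

/-- Along an edge the function is the lower of two lines, one leaving each end with the average
slope rounded up. The factor `2⁻¹` in the definition compensates for each edge occurring in both
orientations. -/
lemma interpolation_edgePoint (y : V → ℝ) (e : Γ.graph.Dart) {t : ℝ}
    (ht : t ∈ Set.Icc 0 (Γ.dartLength e)) : Γ.interpolation y (Γ.edgePoint e t) =
      min (y e.fst + ⌈avgSlope y e⌉ * t)
        (y e.snd + ⌈-avgSlope y e⌉ * (Γ.dartLength e - t)) := by
  have hL := (dartLength_pos e).ne'
  unfold interpolation
  rw [Finset.sum_eq_add (f := fun v => y v * (Γ.edgePoint e t).1 v) e.fst e.snd e.adj.ne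
      (fun v _ hv => by rw [edgePoint_apply_of_ne e ht hv.1 hv.2, mul_zero]) (by simp) (by simp),
    Finset.sum_eq_add e e.symm e.symm_ne.symm ?_ (by simp) (by simp)]
  · have hs : slopeDefect y e = Γ.dartLength e * ⌈avgSlope y e⌉ - (y e.snd - y e.fst) := by
      unfold slopeDefect
      rw [mul_sub]; congr 1; unfold avgSlope; field_simp
    have hs' : slopeDefect y e.symm =
        Γ.dartLength e * ⌈-avgSlope y e⌉ + (y e.snd - y e.fst) := by
      unfold slopeDefect
      rw [avgSlope_symm, dartLength_symm, mul_sub, mul_neg, sub_neg_eq_add]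
      congr 1; unfold avgSlope; field_simp
    have h2 : min (slopeDefect y e.symm * (Γ.edgePoint e t).1 e.symm.snd)
        (slopeDefect y e.symm.symm * (Γ.edgePoint e t).1 e.symm.fst) =
        min (slopeDefect y e * (Γ.edgePoint e t).1 e.snd)
        (slopeDefect y e.symm * (Γ.edgePoint e t).1 e.fst) := by
      rw [SimpleGraph.Dart.symm_symm, min_comm]; rfl
    rw [h2, ← two_mul, inv_mul_cancel_left₀ two_ne_zero, edgePoint_apply_snd e ht,
      edgePoint_apply_fst e ht, ← min_add_add_left, hs, hs']
    congr 1 <;> field_simp <;> ring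
  · intro e' _ he'
    have hnn := edgePoint_apply_nonneg e ht
    have h := edgePoint_apply_eq_zero (e := e') (e' := e) he'.1.symm
      (fun h => he'.2 (by rw [h, SimpleGraph.Dart.symm_symm])) ht
    rcases h with h | h
    · rw [h, mul_zero]
      exact min_eq_right (mul_nonneg (slopeDefect_nonneg _ _) (hnn _))
    · rw [h, mul_zero]
      exact min_eq_left (mul_nonneg (slopeDefect_nonneg _ _) (hnn _))

lemma continuous_interpolation (y : V → ℝ) : Continuous (Γ.interpolation y) := by
  have (v : V) : Continuous fun p : Γ.Point => p.1 v :=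
    (continuous_apply v).comp continuous_subtype_val
  refine (continuous_finsetSum _ fun v _ => (this v).const_mul _).add
    (continuous_const.mul (continuous_finsetSum _ fun e _ => ?_))
  exact ((this _).const_mul _).min ((this _).const_mul _)

lemma hasRightSlope_interpolation_left (y : V → ℝ) (e : Γ.graph.Dart) (t : ℝ) :
    HasRightSlope (fun t => y e.fst + ⌈avgSlope y e⌉ * t) t ⌈avgSlope y e⌉ :=
  Eventually.of_forall fun u => by ring

lemma hasRightSlope_interpolation_right (y : V → ℝ) (e : Γ.graph.Dart) (t : ℝ) :
    HasRightSlope (fun t => y e.snd + ⌈-avgSlope y e⌉ * (Γ.dartLength e - t)) t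
      (-⌈-avgSlope y e⌉) :=
  Eventually.of_forall fun u => by push_cast; ring

lemma hasSlope_interpolation {y : V → ℝ} {e : Γ.graph.Dart} {t : ℝ}
    (ht : t ∈ Set.Ico 0 (Γ.dartLength e)) {m : ℤ} (h : HasRightSlope (fun t =>
      min (y e.fst + ⌈avgSlope y e⌉ * t) (y e.snd + ⌈-avgSlope y e⌉ * (Γ.dartLength e - t))) t m) :
    HasSlope (Γ.interpolation y) (Γ.edgePoint e t) e m := by
  refine (hasSlope_edgePoint ⟨ht.1, ht.2.le⟩).2 (h.congr ?_ ?_)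
  · filter_upwards [eventually_mem_Icc ht] with u hu using interpolation_edgePoint y e hu
  · exact interpolation_edgePoint y e ⟨ht.1, ht.2.le⟩

lemma isRational_interpolation (y : V → ℝ) : Γ.IsRational (Γ.interpolation y) := by
  refine isRational_iff.2 ⟨continuous_interpolation y, ?_⟩
  rintro p e ⟨t, ht, rfl⟩
  obtain ⟨m, hm⟩ := HasRightSlope.exists_min ⟨_, hasRightSlope_interpolation_left y e t⟩
    ⟨_, hasRightSlope_interpolation_right y e t⟩
  exact ⟨m, hasSlope_interpolation ht hm⟩

/-- Rounding up only raises the line from the far end, so at the initial vertex the near line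
attains the minimum and bounds the slope. -/
lemma exists_hasSlope_interpolation_vertex (y : V → ℝ) (e : Γ.graph.Dart) :
    ∃ m ≤ ⌈avgSlope y e⌉, HasSlope (Γ.interpolation y) (Γ.vertex e.fst) e m := by
  have hL := dartLength_pos e
  have h1 := hasRightSlope_interpolation_left y e 0
  have h2 := hasRightSlope_interpolation_right y e 0
  have hle : y e.fst + ⌈avgSlope y e⌉ * 0 ≤
      y e.snd + ⌈-avgSlope y e⌉ * (Γ.dartLength e - 0) := by
    have h3 := mul_le_mul_of_nonneg_right (Int.le_ceil (-avgSlope y e)) hL.le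
    have h4 : avgSlope y e * Γ.dartLength e = y e.snd - y e.fst := by
      unfold avgSlope; field_simp
    linarith
  rw [← edgePoint_zero]
  rcases hle.lt_or_eq with h | h
  · exact ⟨_, le_rfl, hasSlope_interpolation ⟨le_rfl, hL⟩ (h1.min_of_lt h2 h)⟩
  · exact ⟨_, min_le_left _ _, hasSlope_interpolation ⟨le_rfl, hL⟩ (h1.min_of_eq h2 h)⟩

open Classical in
lemma le_div_interpolation_vertex (y : V → ℝ) (v : V) :
    ((-∑ e : Γ.graph.Dart with e.fst = v, ⌈avgSlope y e⌉ : ℤ) : ℝ) ≤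
      Γ.div (Γ.interpolation y) (Γ.vertex v) := by
  choose m hm hm' using exists_hasSlope_interpolation_vertex (Γ := Γ) y
  rw [div_eq (m := m) fun e he => by rw [← mem_directions_vertex.1 he]; exact hm' e, Int.cast_le,
    ← Finset.sum_neg_distrib]
  simp only [mem_directions_vertex]
  exact Finset.sum_le_sum fun e _ => neg_le_neg (hm e)

lemma div_interpolation_edgePoint_nonneg (y : V → ℝ) {e : Γ.graph.Dart} {t : ℝ}
    (ht : t ∈ Set.Ioo 0 (Γ.dartLength e)) :
    0 ≤ Γ.div (Γ.interpolation y) (Γ.edgePoint e t) := by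
  refine (isRational_interpolation y).div_edgePoint_nonneg ht ?_
  have hpos : 0 < min t (Γ.dartLength e - t) := lt_min ht.1 (sub_pos.2 ht.2)
  filter_upwards [Ioo_mem_nhdsGT hpos] with ε hε
  obtain ⟨h1, h2⟩ := hε
  rw [lt_min_iff] at h2
  rw [interpolation_edgePoint y e ⟨ht.1.le, ht.2.le⟩,
    interpolation_edgePoint y e ⟨by linarith [ht.1], by linarith [h2.2]⟩,
    interpolation_edgePoint y e ⟨by linarith [h2.1], by linarith [ht.2]⟩]
  set A := (⌈avgSlope y e⌉ : ℝ)
  set B := (⌈-avgSlope y e⌉ : ℝ)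
  rcases min_choice (y e.fst + A * t) (y e.snd + B * (Γ.dartLength e - t)) with h | h <;> rw [h]
  · linarith [min_le_left (y e.fst + A * (t + ε)) (y e.snd + B * (Γ.dartLength e - (t + ε))),
      min_le_left (y e.fst + A * (t - ε)) (y e.snd + B * (Γ.dartLength e - (t - ε)))]
  · linarith [min_le_right (y e.fst + A * (t + ε)) (y e.snd + B * (Γ.dartLength e - (t + ε))),
      min_le_right (y e.fst + A * (t - ε)) (y e.snd + B * (Γ.dartLength e - (t - ε)))]

open Classical in
/-- A vertex potential whose rounded-up outgoing slopes are bounded by the coefficients of a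
divisor on the vertices yields an effective divisor. -/
lemma linearSystem_vertexDivisor_nonempty {b : V → ℤ} (y : V → ℝ)
    (h : ∀ v, ∑ e : Γ.graph.Dart with e.fst = v, ⌈avgSlope y e⌉ ≤ b v) :
    (Γ.linearSystem (Γ.vertexDivisor b)).Nonempty := by
  obtain ⟨D', hD', -⟩ := exists_mem_linearSystem (D := Γ.vertexDivisor b)
      (isRational_interpolation y) fun p => by
    obtain ⟨v, rfl⟩ | ⟨e, t, ht, rfl⟩ := eq_vertex_or_edgePoint p
    · rw [vertexDivisor_vertex]
      have h1 := le_div_interpolation_vertex (Γ := Γ) y v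
      have h2 : ((∑ e : Γ.graph.Dart with e.fst = v, ⌈avgSlope y e⌉ : ℤ) : ℝ) ≤ b v :=
        Int.cast_le.2 (h v)
      rw [Int.cast_neg] at h1
      linarith
    · rw [vertexDivisor_of_ne]
      · simpa using div_interpolation_edgePoint_nonneg y ht
      · intro v hv
        have h1 := (mem_directions_edgePoint_iff ht).2 (Or.inl rfl)
        have h2 := (mem_directions_edgePoint_iff ht).2 (Or.inr rfl)
        rw [hv, mem_directions_vertex] at h1 h2
        exact e.adj.ne (h1.trans h2.symm)
  exact ⟨D', hD'⟩

/-! ### Concavity along an edge. -/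

/-- A rational function with nonnegative divisor in the interior of `e` lies below its tangent
line at the initial vertex of `e`. -/
lemma le_add_slope_mul {f : Γ.Point → ℝ} (hf : Γ.IsRational f) {e : Γ.graph.Dart} {m : ℤ}
    (hm : HasSlope f (Γ.vertex e.fst) e m)
    (hdiv : ∀ t ∈ Set.Ioo 0 (Γ.dartLength e), 0 ≤ Γ.div f (Γ.edgePoint e t)) :
    f (Γ.vertex e.snd) ≤ f (Γ.vertex e.fst) + m * Γ.dartLength e := by
  have hL := dartLength_pos e
  by_contra! hlt
  set g := fun t => f (Γ.edgePoint e t) with hg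
  have hg0 : g 0 = f (Γ.vertex e.fst) := by rw [hg]; simp only [edgePoint_zero]
  have hgL : g (Γ.dartLength e) = f (Γ.vertex e.snd) := by
    rw [hg]; simp only [edgePoint_dartLength]
  have hcont : Continuous g := hf.1.comp (continuous_edgePoint e)
  -- The tilt `m + δ` is strictly between consecutive integers, and the end value still lies above
  -- the tilted line. Subtracting that line leaves a minimum in the interior of the edge.
  obtain ⟨δ, hδ0, hδ1, hδ⟩ : ∃ δ : ℝ, 0 < δ ∧ δ < 1 ∧
      f (Γ.vertex e.fst) + (m + δ) * Γ.dartLength e < f (Γ.vertex e.snd) := by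
    have h0 : 0 < (f (Γ.vertex e.snd) - (f (Γ.vertex e.fst) + m * Γ.dartLength e)) /
        Γ.dartLength e := div_pos (sub_pos.2 hlt) hL
    obtain ⟨δ, h1, h2⟩ := exists_between (lt_min h0 one_pos)
    rw [lt_min_iff, lt_div_iff₀ hL] at h2
    exact ⟨δ, h1, h2.2, by linarith [h2.1]⟩
  obtain ⟨t, ht, hmin⟩ := (isCompact_Icc (a := 0) (b := Γ.dartLength e)).exists_isMinOn
    ⟨0, le_rfl, hL.le⟩ ((hcont.sub (continuous_const.mul continuous_id :
      Continuous fun t => (m + δ) * t)).continuousOn)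
  have hmin' : ∀ s ∈ Set.Icc 0 (Γ.dartLength e), g t - (m + δ) * t ≤ g s - (m + δ) * s :=
    fun s hs => hmin hs
  rw [← edgePoint_zero, hasSlope_edgePoint ⟨le_rfl, hL.le⟩, hasRightSlope_iff] at hm
  have ht0 : t ≠ 0 := by
    rintro rfl
    obtain ⟨ε, h1, h2⟩ := (hm.and (Ioo_mem_nhdsGT hL)).exists
    have h3 := hmin' ε ⟨h2.1.le, h2.2.le⟩
    have h1' : g ε = g 0 + m * ε := by simpa using h1
    rw [h1'] at h3
    nlinarith [mul_pos hδ0 h2.1]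
  have htL : t ≠ Γ.dartLength e := by
    rintro rfl
    have := hmin' 0 ⟨le_rfl, hL.le⟩
    rw [hg0, hgL] at this
    linarith
  have htI : t ∈ Set.Ioo 0 (Γ.dartLength e) :=
    ⟨lt_of_le_of_ne ht.1 ht0.symm, lt_of_le_of_ne ht.2 htL⟩
  have hr := (isRational_iff.1 hf).2 (Γ.edgePoint e t)
  obtain ⟨k, hk⟩ := hr e (mem_directions_edgePoint e ⟨ht.1, htI.2⟩)
  obtain ⟨n, hn⟩ := hr e.symm (symm_mem_directions_edgePoint e ⟨htI.1, ht.2⟩)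
  have hkn := hdiv t htI
  rw [div_edgePoint htI hk hn] at hkn
  have hkn' : k + n ≤ 0 := by
    have : (0 : ℤ) ≤ -k - n := by exact_mod_cast hkn
    omega
  have hpos : 0 < min t (Γ.dartLength e - t) := lt_min htI.1 (sub_pos.2 htI.2)
  obtain ⟨ε, h1, h2, h3, h4⟩ := ((hasRightSlope_iff.1 ((hasSlope_edgePoint ht).1 hk)).and
    (((hasSlope_edgePoint_symm ⟨htI.1, ht.2⟩).1 hn).and (Ioo_mem_nhdsGT hpos))).exists
  rw [lt_min_iff] at h4
  have h5 := hmin' (t + ε) ⟨by linarith, by linarith⟩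
  have h6 := hmin' (t - ε) ⟨by linarith, by linarith⟩
  have h1' : g (t + ε) = g t + k * ε := h1
  have h2' : g (t - ε) = g t + n * ε := h2
  rw [h1'] at h5
  rw [h2'] at h6
  have h7 : (m + δ : ℝ) ≤ k := le_of_mul_le_mul_right (by linarith) h3
  have h8 : -(m + δ : ℝ) ≤ n := le_of_mul_le_mul_right (by linarith) h3
  -- Integrality sharpens `k ≥ m + δ` and `n ≥ -(m + δ)` to `k ≥ m + 1` and `n ≥ -m`, so `k + n ≥
  -- 1`, against the sign of `div`.
  have h9 : m + 1 ≤ k := by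
    have : (m : ℝ) < k := by linarith
    exact_mod_cast this
  have h10 : -m ≤ n := by
    have : (-m - 1 : ℝ) < n := by linarith
    have : -m - 1 < n := by exact_mod_cast this
    omega
  omega

/-! ### Potentials that pay the debt of one vertex. -/

lemma sum_ceil_eq_of_const {l : V → V → ℝ} {c : ℝ} (u v : V) (huv : u ≠ v) :
    ∑ t, ⌈((if u = v then 0 else c) - (if t = v then 0 else c)) / l u t⌉ = ⌈c / l u v⌉ := by
  rw [Finset.sum_eq_single v]
  · simp [huv]
  · intro t _ ht; simp [ht, huv]
  · simp

lemma ceil_div_le {x l : ℝ} (hl : 0 < l) {k : ℤ} (h : x ≤ k * l) : ⌈x / l⌉ ≤ k :=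
  Int.ceil_le.2 ((div_le_iff₀ hl).2 h)

/-- Moving chips at constant speed from all other vertices towards `v`. -/
lemma exists_potential_of_const {l : V → V → ℝ} (hl : ∀ u w, 0 < l u w)
    (hs : ∀ u w, l u w = l w u) {b : V → ℤ} {v p q r : V} (hp : p ≠ v) (hq : q ≠ v ∧ q ≠ p)
    (hr : r ≠ v ∧ r ≠ p ∧ r ≠ q) {c : ℝ} (hc : 0 ≤ c) (hb : ∀ u ≠ v, ⌈c / l v u⌉ ≤ b u)
    (i j k : ℤ) (hi : i * l v p ≤ c) (hj : j * l v q ≤ c) (hk : k * l v r ≤ c)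
    (hbv : -b v ≤ i + j + k) :
    ∃ x : V → ℝ, ∀ u, ∑ w, ⌈(x u - x w) / l u w⌉ ≤ b u := by
  refine ⟨fun u => if u = v then 0 else c, fun u => ?_⟩
  by_cases huv : u = v
  · subst huv
    have : ∑ w, ⌈((if u = u then 0 else c) - (if w = u then 0 else c)) / l u w⌉ ≤
        ∑ w, ((if w = p then -i else 0) + (if w = q then -j else 0) +
          (if w = r then -k else 0)) := by
      refine Finset.sum_le_sum fun w _ => ?_
      by_cases hw : w = u
      · subst hw; simp [hp.symm, hq.1.symm, hr.1.symm]
      rw [if_pos rfl, if_neg hw]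
      refine ceil_div_le (hl _ _) ?_
      by_cases hwp : w = p
      · subst hwp
        rw [if_pos rfl, if_neg hq.2.symm, if_neg hr.2.1.symm]
        push_cast; linarith
      by_cases hwq : w = q
      · subst hwq
        rw [if_neg hwp, if_pos rfl, if_neg hr.2.2.symm]
        push_cast; linarith
      rw [if_neg hwp, if_neg hwq]
      split_ifs with hwr
      · subst hwr; push_cast; linarith
      · push_cast; linarith
    refine this.trans ?_
    rw [Finset.sum_add_distrib, Finset.sum_add_distrib]
    simp only [Finset.sum_ite_eq', Finset.mem_univ, if_true]
    omega
  · have := sum_ceil_eq_of_const (l := l) (c := c) u v huv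
    simp only at this ⊢
    rw [this, hs]
    exact hb u huv

/-- Moving chips towards `v` when `w` has only just enough chips to reach `v`, with the other
vertices refilling `w`. -/
lemma exists_potential_of_refill {l : V → V → ℝ} (hl : ∀ u w, 0 < l u w)
    (hs : ∀ u w, l u w = l w u) {b : V → ℤ} {v w : V} (hvw : v ≠ w) {s : ℤ} (hs0 : 0 ≤ s)
    (hv : -(s + 1) ≤ b v) (hw : s ≤ b w) (hb : ∀ u, u ≠ v → u ≠ w → 2 ≤ b u)
    (hsl : ∀ u, u ≠ v → u ≠ w → s * l v w ≤ l v u) (hex : ∃ u, u ≠ v ∧ u ≠ w) :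
    ∃ x : V → ℝ, ∀ u, ∑ w, ⌈(x u - x w) / l u w⌉ ≤ b u := by
  obtain ⟨u₀, hu₀⟩ := hex
  have hne : (Finset.univ.filter fun u => u ≠ v ∧ u ≠ w).Nonempty := ⟨u₀, by simpa using hu₀⟩
  obtain ⟨p, hp, hpm⟩ := Finset.exists_min_image _ (l v) hne
  obtain ⟨q, hq, hqm⟩ := Finset.exists_min_image _ (l w) hne
  simp only [Finset.mem_filter, Finset.mem_univ, true_and, and_imp] at hp hq hpm hqm
  have hsp := hsl p hp.1 hp.2
  have hL := hl v w
  have hq0 := hl w q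
  -- `β` and `γ` are the potentials of `w` and of the remaining vertices, with `v` at 0. Here `β` is
  -- `l v p - l w q` clamped between `s * l v w` and `(s + 1) * l v w`, and `γ` is the smaller of `l
  -- v p` and `β + l w q`, so chips from the remaining vertices overshoot neither `v` nor `w`. The
  -- first disjunction says that `w` sends at most `s` chips, or `s + 1` with one refilled from `q`;
  -- the second that `v` receives `s + 1` chips from `w`, or `s` from `w` and one from `p`.
  obtain ⟨β, γ, h1, h2, h3, h4, h5, h6⟩ : ∃ β γ : ℝ, β ≤ γ ∧ s * l v w ≤ β ∧ γ ≤ l v p ∧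
      γ ≤ β + l w q ∧ (β ≤ s * l v w ∨ β ≤ (s + 1) * l v w ∧ γ = β + l w q) ∧
      ((s + 1) * l v w ≤ β ∨ γ = l v p) := by
    rcases le_total (l v p - l w q) (s * l v w) with h | h
    · exact ⟨s * l v w, l v p, hsp, le_rfl, le_rfl, by linarith, Or.inl le_rfl, Or.inr rfl⟩
    rcases le_total ((s + 1) * l v w) (l v p - l w q) with h' | h'
    · exact ⟨(s + 1) * l v w, (s + 1) * l v w + l w q, by linarith, by linarith, by linarith,
        le_rfl, Or.inr ⟨le_rfl, rfl⟩, Or.inl le_rfl⟩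
    · exact ⟨l v p - l w q, l v p, by linarith, h, le_rfl, by linarith,
        Or.inr ⟨h', by ring⟩, Or.inr rfl⟩
  have hβ : 0 ≤ β := le_trans (mul_nonneg (by exact_mod_cast hs0) hL.le) h2
  let x : V → ℝ := fun u => if u = v then 0 else if u = w then β else γ
  have xv : x v = 0 := by simp [x]
  have xw : x w = β := by simp [x, hvw.symm]
  have xu : ∀ u, u ≠ v → u ≠ w → x u = γ := fun u hu hu' => by simp [x, hu, hu']
  have hsum : ∀ (i j : V) (m n : ℤ),
      ∑ t, ((if t = i then m else 0) + (if t = j then n else 0)) = m + n := by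
    intro i j m n
    rw [Finset.sum_add_distrib]; simp
  refine ⟨x, fun u => ?_⟩
  by_cases huv : u = v
  · subst huv
    have key : ∀ k : ℤ, k * l u w ≤ β → ∀ n : ℤ, 0 ≤ n → n * l u p ≤ γ → s + 1 ≤ k + n →
        ∑ t, ⌈(x u - x t) / l u t⌉ ≤ b u := by
      intro k hk n hn hn' hkn
      refine le_trans (Finset.sum_le_sum (g := fun t => (if t = w then -k else 0) +
        (if t = p then -n else 0)) fun t _ => ?_) ?_
      · by_cases ht : t = u
        · subst ht; simp [hvw, hp.1.symm]
        by_cases htw : t = w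
        · subst htw
          rw [if_pos rfl, if_neg hp.2.symm, add_zero, xv, xw]
          exact ceil_div_le (hl _ _) (by push_cast; linarith)
        · rw [xv, xu t ht htw, if_neg htw, zero_add]
          split_ifs with htp
          · subst htp
            exact ceil_div_le (hl _ _) (by push_cast; linarith)
          · exact ceil_div_le (hl _ _) (by push_cast; linarith)
      · rw [hsum]; omega
    rcases h6 with h6 | h6
    · exact key (s + 1) (by push_cast; exact h6) 0 le_rfl (by push_cast; linarith) (by omega)
    · exact key s h2 1 (by norm_num) (by rw [h6]; push_cast; linarith) le_rfl
  by_cases huw : u = w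
  · subst huw
    have key : ∀ k : ℤ, β ≤ k * l v u → ∀ n : ℤ, 0 ≤ n → n * l u q ≤ γ - β → k - n ≤ s →
        ∑ t, ⌈(x u - x t) / l u t⌉ ≤ b u := by
      intro k hk n hn hn' hkn
      refine le_trans (Finset.sum_le_sum (g := fun t => (if t = v then k else 0) +
        (if t = q then -n else 0)) fun t _ => ?_) ?_
      · by_cases ht : t = u
        · subst ht; simp [hvw.symm, hq.2.symm]
        by_cases htv : t = v
        · subst htv
          rw [if_pos rfl, if_neg hq.1.symm, add_zero, xv, xw]
          exact ceil_div_le (hl _ _) (by rw [hs]; linarith)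
        · rw [xw, xu t htv ht, if_neg htv, zero_add]
          split_ifs with htq
          · subst htq
            exact ceil_div_le (hl _ _) (by push_cast; linarith)
          · exact ceil_div_le (hl _ _) (by push_cast; linarith)
      · rw [hsum]; omega
    rcases h5 with h5 | ⟨h5, h5'⟩
    · exact key s h5 0 le_rfl (by push_cast; linarith) (by omega)
    · exact key (s + 1) (by push_cast; exact h5) 1 (by norm_num)
        (by rw [h5']; push_cast; linarith) (by omega)
  · refine le_trans (Finset.sum_le_sum (g := fun t => (if t = v then (1 : ℤ) else 0) +
        (if t = w then 1 else 0)) fun t _ => ?_) ?_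
    · rw [xu u huv huw]
      by_cases htv : t = v
      · subst htv
        rw [if_pos rfl, if_neg hvw, add_zero, xv]
        exact ceil_div_le (hl _ _) (by rw [hs]; push_cast; linarith [hpm u huv huw])
      by_cases htw : t = w
      · subst htw
        rw [if_pos rfl, if_neg hvw.symm, zero_add, xw]
        exact ceil_div_le (hl _ _) (by rw [hs]; push_cast; linarith [hqm u huv huw])
      · rw [xu t htv htw]; simp [htv, htw]
    · rw [hsum]; exact hb u huv huw

/-- Since the sum is 5, at most one vertex `v` has `a v > 2`, and few chips are removed elsewhere.
The three vertices `p`, `q`, `r` nearest to `v`, in this order, decide which move pays the debt. -/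
lemma exists_potential {l : V → V → ℝ} (hl : ∀ u w, 0 < l u w)
    (hs : ∀ u w, l u w = l w u) (hV : 4 ≤ Fintype.card V) {a : V → ℤ} (ha : 0 ≤ a)
    (hsum : ∑ v, a v = 5) :
    ∃ x : V → ℝ, ∀ u, ∑ w, ⌈(x u - x w) / l u w⌉ ≤ 2 - a u := by
  have ha0 : ∀ u, 0 ≤ a u := ha
  by_cases hle : ∀ v, a v ≤ 2
  · exact ⟨0, fun u => by simpa using hle u⟩
  push Not at hle
  obtain ⟨v, hv⟩ := hle
  have hT : ∀ T : Finset V, ∑ u ∈ T, a u ≤ 5 := fun T => by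
    rw [← hsum]
    exact Finset.sum_le_sum_of_subset_of_nonneg (Finset.subset_univ T) fun u _ _ => ha0 u
  have h1 : a v ≤ 5 := by simpa using hT {v}
  have h2 : ∀ w ≠ v, a v + a w ≤ 5 := fun w hw => by
    simpa [Finset.sum_pair hw.symm] using hT {v, w}
  have h3 : ∀ w u, w ≠ v → u ≠ v → u ≠ w → a v + a w + a u ≤ 5 := fun w u hw hu huw => by
    have := hT {v, w, u}
    rw [Finset.sum_insert (by simp [hw.symm, hu.symm]), Finset.sum_pair huw.symm] at this
    linarith
  have hmin : ∀ S : Finset V, S.card < 4 →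
      ∃ u, u ∉ S ∧ ∀ t, t ∉ S → l v u ≤ l v t := by
    intro S hS
    have hne : (Finset.univ \ S).Nonempty := by
      rw [← Finset.card_pos, Finset.card_sdiff_of_subset (Finset.subset_univ S), Finset.card_univ]
      omega
    obtain ⟨u, hu, hum⟩ := Finset.exists_min_image _ (l v) hne
    exact ⟨u, by simpa using hu, fun t ht => hum t (by simpa using ht)⟩
  have hex : ∀ w, ∃ u, u ≠ v ∧ u ≠ w := fun w => by
    obtain ⟨u, hu, -⟩ := hmin {v, w} (Finset.card_le_two.trans_lt (by norm_num))
    exact ⟨u, by simpa using hu⟩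
  obtain ⟨p, hp, hpm⟩ := hmin {v} (by simp)
  simp only [Finset.mem_singleton] at hp hpm
  obtain ⟨q, hq, hqm⟩ := hmin {v, p} (Finset.card_le_two.trans_lt (by norm_num))
  simp only [Finset.mem_insert, Finset.mem_singleton, not_or] at hq hqm
  obtain ⟨r, hr, hrm⟩ := hmin {v, p, q} (Finset.card_le_three.trans_lt (by norm_num))
  simp only [Finset.mem_insert, Finset.mem_singleton, not_or] at hr hrm
  have hlp := hl v p
  have hpq : l v p ≤ l v q := hpm q hq.1
  have hqr : l v q ≤ l v r := hqm r ⟨hr.1, hr.2.1⟩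
  have hqu : ∀ u, u ≠ v → u ≠ p → l v q ≤ l v u := fun u hu hu' => hqm u ⟨hu, hu'⟩
  obtain hv3 | hv4 | hv5 : a v = 3 ∨ a v = 4 ∨ a v = 5 := by omega
  -- Debt 1. Either some `w` has no chips and must be refilled before it can send one, or everyone
  -- can spare a chip and the nearest vertex pays.
  · by_cases hw : ∃ w ≠ v, 2 ≤ a w
    · obtain ⟨w, hwv, hw2⟩ := hw
      refine exists_potential_of_refill hl hs hwv.symm (s := 0) le_rfl (by omega)
        (by have := h2 w hwv; omega) (fun u hu hu' => ?_) (fun u _ _ => ?_) (hex w)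
      · have := h3 w u hwv hu hu'; omega
      · push_cast; linarith [hl v u]
    · push Not at hw
      refine exists_potential_of_const hl hs hp hq hr hlp.le (fun u hu => ?_) 1 0 0
        (by push_cast; linarith) (by push_cast; linarith) (by push_cast; linarith) (by omega)
      refine le_trans (ceil_div_le (k := 1) (hl _ _) ?_) (by have := hw u hu; omega)
      push_cast; linarith [hpm u hu]
  -- Debt 2. If `p` has only one chip, it is refilled. Otherwise motion stops when `v` has received
  -- two chips: both from `p`, or one each from `p` and `q`.
  · by_cases hap : 1 ≤ a p
    · refine exists_potential_of_refill hl hs (Ne.symm hp) (s := 1) zero_le_one (by omega)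
        (by have := h2 p hp; omega) (fun u hu hu' => ?_) (fun u hu _ => ?_) (hex p)
      · have := h3 p u hp hu hu'; omega
      · push_cast; linarith [hpm u hu]
    · have hc0 : l v p ≤ min (2 * l v p) (l v q) := le_min (by linarith) hpq
      have hbu : ∀ u ≠ v, ⌈min (2 * l v p) (l v q) / l v u⌉ ≤ 2 - a u := fun u hu => by
        by_cases hup : u = p
        · subst hup
          exact le_trans (ceil_div_le (k := 2) (hl _ _) (by push_cast; exact min_le_left _ _))
            (by omega)
        · refine le_trans (ceil_div_le (k := 1) (hl _ _) ?_) (by have := h2 u hu; omega)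
          push_cast
          linarith [min_le_right (2 * l v p) (l v q), hqu u hu hup]
      rcases min_choice (2 * l v p) (l v q) with h | h
      · exact exists_potential_of_const hl hs hp hq hr (hlp.le.trans hc0) hbu 2 0 0
          (by rw [h]; push_cast; linarith) (by push_cast; linarith) (by push_cast; linarith)
          (by omega)
      · exact exists_potential_of_const hl hs hp hq hr (hlp.le.trans hc0) hbu 1 1 0
          (by push_cast; linarith) (by rw [h]; push_cast; linarith) (by push_cast; linarith)
          (by omega)
  -- Debt 3, with two chips at every other vertex. If `p` would use up both before `q` contributes,
  -- it is refilled. Otherwise the third chip to arrive is the second from `p` or the first from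
  -- `r`.
  · by_cases hlq : 2 * l v p ≤ l v q
    · refine exists_potential_of_refill hl hs (Ne.symm hp) (s := 2) zero_le_two (by omega)
        (by have := h2 p hp; omega) (fun u hu hu' => ?_) (fun u hu hu' => ?_) (hex p)
      · have := h2 u hu; omega
      · push_cast; linarith [hqu u hu hu']
    · have hc0 : l v q ≤ min (2 * l v p) (l v r) := le_min (by linarith) hqr
      have hbu : ∀ u ≠ v, ⌈min (2 * l v p) (l v r) / l v u⌉ ≤ 2 - a u := fun u hu => by
        refine le_trans (ceil_div_le (k := 2) (hl _ _) ?_) (by have := h2 u hu; omega)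
        push_cast
        linarith [min_le_left (2 * l v p) (l v r), hpm u hu]
      rcases min_choice (2 * l v p) (l v r) with h | h
      · exact exists_potential_of_const hl hs hp hq hr (by linarith) hbu 2 1 0
          (by rw [h]; push_cast; linarith) (by push_cast; linarith) (by push_cast; linarith)
          (by omega)
      · exact exists_potential_of_const hl hs hp hq hr (by linarith) hbu 1 1 1
          (by push_cast; linarith) (by push_cast; linarith) (by rw [h]; push_cast; linarith)
          (by omega)

/-! ### The lower bound on the complete metric graph. -/

open Classical in
/-- The length of the edge `uw`, with the value `1` if there is no such edge. -/
noncomputable def edgeLength (Γ : MetricGraph V) (u w : V) : ℝ :=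
  if h : Γ.graph.Adj u w then Γ.dartLength ⟨(u, w), h⟩ else 1

lemma edgeLength_pos (u w : V) : 0 < Γ.edgeLength u w := by
  unfold edgeLength
  split_ifs
  · exact dartLength_pos _
  · exact one_pos

lemma edgeLength_comm (u w : V) : Γ.edgeLength u w = Γ.edgeLength w u := by
  unfold edgeLength
  by_cases h : Γ.graph.Adj u w
  · rw [dif_pos h, dif_pos h.symm, ← dartLength_symm]; rfl
  · rw [dif_neg h, dif_neg fun h' => h h'.symm]

open Classical in
lemma sum_dart_fst_eq {F : Γ.graph.Dart → ℤ} (u : V) :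
    ∑ e : Γ.graph.Dart with e.fst = u, F e =
      ∑ w with Γ.graph.Adj u w, if h : Γ.graph.Adj u w then F ⟨(u, w), h⟩ else 0 := by
  refine Finset.sum_bij (fun e _ => e.snd) (fun e he => ?_) (fun e he e' he' h => ?_)
    (fun w hw => ?_) fun e he => ?_
  · rw [Finset.mem_filter] at he
    simp [← he.2, e.adj]
  · rw [Finset.mem_filter] at he he'
    exact SimpleGraph.Dart.ext _ _ (Prod.ext (he.2.trans he'.2.symm) h)
  · exact ⟨⟨(u, w), (Finset.mem_filter.1 hw).2⟩, by simp, rfl⟩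
  · obtain rfl := (Finset.mem_filter.1 he).2
    rw [dif_pos e.adj]

lemma linearSystem_sub_nonempty (hΓ : Γ.graph = ⊤) (hV : 4 ≤ Fintype.card V) {a : V → ℤ}
    (ha : 0 ≤ a) (hsum : ∑ v, a v = 5) :
    (Γ.linearSystem (Γ.vertexDivisor (fun v => 2 - a v))).Nonempty := by
  classical
  obtain ⟨x, hx⟩ := exists_potential (edgeLength_pos (Γ := Γ)) edgeLength_comm hV ha hsum
  -- In `x` chips flow from high to low potential; outgoing slopes of the rational function count
  -- departing chips, hence the sign.
  refine linearSystem_vertexDivisor_nonempty (-x) fun v => ?_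
  rw [sum_dart_fst_eq]
  refine le_trans (le_of_eq ?_) (hx v)
  rw [Finset.sum_filter]
  refine Finset.sum_congr rfl fun w _ => ?_
  by_cases h : v = w
  · subst h; simp
  · have hadj : Γ.graph.Adj v w := by rw [hΓ]; exact h
    rw [if_pos hadj, dif_pos hadj]
    unfold avgSlope edgeLength
    rw [dif_pos hadj]
    simp only [Pi.neg_apply]
    congr 2; ring

/-! ### The upper bound. -/

-- By concavity, the outgoing slope at a minimal vertex is at least the average slope to each
-- neighbour: nonnegative always, and at least 1 by integrality if the neighbour is higher. Their
-- sum is at most `b u` because `F` is effective at `u`.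
open Classical in
lemma card_lt_le_of_linearlyEquivalent (hΓ : Γ.graph = ⊤) {b : V → ℤ} {F : Γ.Divisor}
    (hF : 0 ≤ F) {f : Γ.Point → ℝ} (hf : Γ.IsRational f)
    (h : ∀ p, (((F - Γ.vertexDivisor b) p : ℤ) : ℝ) = Γ.div f p) {u : V}
    (hu : ∀ w, f (Γ.vertex u) ≤ f (Γ.vertex w)) :
    ((Finset.univ.filter fun w => f (Γ.vertex u) < f (Γ.vertex w)).card : ℤ) ≤ b u := by
  obtain ⟨m, hm⟩ := hf.exists_slopes (Γ.vertex u)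
  have hdiv : ∀ e : Γ.graph.Dart, ∀ t ∈ Set.Ioo 0 (Γ.dartLength e),
      0 ≤ Γ.div f (Γ.edgePoint e t) := by
    intro e t ht
    rw [← h, Finsupp.sub_apply, vertexDivisor_of_ne, sub_zero]
    · exact_mod_cast hF _
    · intro v hv
      have h1 := (mem_directions_edgePoint_iff ht).2 (Or.inl rfl)
      have h2 := (mem_directions_edgePoint_iff ht).2 (Or.inr rfl)
      rw [hv, mem_directions_vertex] at h1 h2
      exact e.adj.ne (h1.trans h2.symm)
  have hle : ∀ e : Γ.graph.Dart, e.fst = u →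
      f (Γ.vertex e.snd) ≤ f (Γ.vertex u) + m e * Γ.dartLength e := by
    rintro e rfl
    exact le_add_slope_mul hf (hm e (mem_directions_vertex.2 rfl)) (hdiv e)
  have hsum : ∑ e : Γ.graph.Dart with e.fst = u, m e ≤ b u := by
    have h1 := h (Γ.vertex u)
    rw [div_eq hm, Int.cast_inj, Finsupp.sub_apply, vertexDivisor_vertex,
      Finset.sum_neg_distrib] at h1
    simp only [mem_directions_vertex] at h1
    have h2 : 0 ≤ F (Γ.vertex u) := hF _
    omega
  refine le_trans ?_ hsum
  rw [sum_dart_fst_eq, Finset.sum_filter, Finset.card_filter, Nat.cast_sum]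
  refine Finset.sum_le_sum fun w _ => ?_
  by_cases huw : u = w
  · subst huw; simp
  have hadj : Γ.graph.Adj u w := by rw [hΓ]; exact huw
  rw [if_pos hadj, dif_pos hadj]
  have h1 := hle ⟨(u, w), hadj⟩ rfl
  have hL := dartLength_pos (⟨(u, w), hadj⟩ : Γ.graph.Dart)
  split_ifs with hlt
  · have : (0 : ℝ) < m ⟨(u, w), hadj⟩ := by
      by_contra! hneg
      have := mul_nonpos_of_nonpos_of_nonneg hneg hL.le
      simp only at h1
      linarith
    have : 0 < m ⟨(u, w), hadj⟩ := by exact_mod_cast this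
    push_cast; omega
  · have : (0 : ℝ) ≤ m ⟨(u, w), hadj⟩ := by
      by_contra! hneg
      have := mul_neg_of_neg_of_pos hneg hL
      have := hu w
      simp only at h1
      linarith
    exact_mod_cast this

/-- A burning argument: once `k` vertices are known not to be minima of `f`, neither is any vertex
with fewer than `k` chips. The fire takes `p`, `q`, `r` in turn and then every vertex, including the
minimum. -/
lemma linearSystem_eq_empty (hΓ : Γ.graph = ⊤) {b : V → ℤ} {p q r : V} (hpq : p ≠ q)
    (hpr : p ≠ r) (hqr : q ≠ r) (hp : b p < 0) (hq : b q ≤ 0) (hr : b r ≤ 1)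
    (hb : ∀ v, b v ≤ 2) : Γ.linearSystem (Γ.vertexDivisor b) = ∅ := by
  classical
  refine Set.eq_empty_of_forall_notMem ?_
  rintro F ⟨hF, f, hf, h⟩
  have : Nonempty V := ⟨p⟩
  obtain ⟨u, hu⟩ := Finite.exists_min fun v => f (Γ.vertex v)
  have step : ∀ (T : Finset V) (w : V), (∀ w ∈ T, f (Γ.vertex u) < f (Γ.vertex w)) →
      b w < T.card → f (Γ.vertex u) < f (Γ.vertex w) := by
    intro T w hT hw
    refine lt_of_le_of_ne (hu w) fun heq => ?_
    have hu' : ∀ w', f (Γ.vertex w) ≤ f (Γ.vertex w') := fun w' => heq ▸ hu w'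
    have h1 := card_lt_le_of_linearlyEquivalent hΓ hF hf h hu'
    have h2 : T.card ≤ (Finset.univ.filter fun w' => f (Γ.vertex w) < f (Γ.vertex w')).card :=
      Finset.card_le_card fun w' hw' => by simpa [← heq] using hT w' hw'
    have : (T.card : ℤ) ≤ b w := le_trans (by exact_mod_cast h2) h1
    omega
  have hp' := step ∅ p (by simp) (by simpa using hp)
  have hq' := step {p} q (by simpa using hp') (by simp; omega)
  have hr' := step {p, q} r (by simp [hp', hq']) (by rw [Finset.card_pair hpq]; push_cast; omega)
  have hu' := step {p, q, r} u (by simp [hp', hq', hr'])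
    (by rw [Finset.card_eq_three.2 ⟨p, q, r, hpq, hpr, hqr, rfl⟩]; have := hb u; push_cast; omega)
  exact lt_irrefl _ hu'

/-! ### The rank. -/

/-- Twice the sum of the vertices of a complete metric graph has rank `5`. -/
theorem rank_two_mul_vertices (hΓ : Γ.graph = ⊤) (hV : 4 ≤ Fintype.card V) :
    Γ.rank (Γ.vertexDivisor fun _ => 2) = 5 := by
  classical
  have hne : Γ.linearSystem (Γ.vertexDivisor fun _ => 2) ≠ ∅ :=
    Set.Nonempty.ne_empty ⟨_, vertexDivisor_nonneg fun _ => by norm_num, .refl _⟩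
  unfold rank
  rw [if_neg hne]
  have hgreatest : IsGreatest {r : ℕ | ∀ E : Γ.Divisor, 0 ≤ E → Γ.degree E = r →
      (Γ.linearSystem (Γ.vertexDivisor (fun _ => 2) - E)).Nonempty} 5 := by
    constructor
    · refine linearSystem_sub_nonempty_of_vertices 5 _ fun a ha hsum => ?_
      rw [← vertexDivisor_sub]
      exact linearSystem_sub_nonempty hΓ hV ha hsum
    · intro n hn
      by_contra! hlt
      obtain ⟨p, q, r, hpq, hpr, hqr⟩ := Fintype.two_lt_card_iff.1 (by omega : 2 < Fintype.card V)
      -- Subtracting this leaves `5 - n < 0`, `0` and `1` chips at `p`, `q`, `r`, as burning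
      -- requires. Every `n > 5` is excluded directly, so 5 is an upper bound of the set under
      -- `sSup`.
      let a : V → ℤ := fun v => (if v = p then (n : ℤ) - 3 else 0) + (if v = q then 2 else 0) +
        (if v = r then 1 else 0)
      have ha : 0 ≤ a := fun v => by
        simp only [a, Pi.zero_apply]
        split_ifs <;> omega
      have hsum : ∑ v, a v = n := by
        simp only [a, Finset.sum_add_distrib, Finset.sum_ite_eq', Finset.mem_univ, if_true]
        ring
      have hn' := hn (Γ.vertexDivisor a) (vertexDivisor_nonneg ha)
        ((degree_vertexDivisor a).trans hsum)
      rw [← vertexDivisor_sub, linearSystem_eq_empty hΓ hpq hpr hqr] at hn'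
      · exact Set.not_nonempty_empty hn'
      · simp only [Pi.sub_apply, a, if_pos, hpq, hpr, if_false]; omega
      · simp [a, hpq.symm, hqr]
      · simp [a, hpr.symm, hqr.symm]
      · intro v; have := ha v; simp only [Pi.sub_apply, Pi.zero_apply] at this ⊢; omega
  rw [hgreatest.csSup_eq]
  rfl

end MetricGraph

theorem mainTheorem7 (d : ℕ) (hd : 5 ≤ d)
    (ℓ : (⊤ : SimpleGraph (Fin d)).edgeSet → ℝ) (hℓ : ∀ e, 0 < ℓ e) :
    (MetricGraph.complete d ℓ hℓ).rank
      (∑ i : Fin d, Finsupp.single ((MetricGraph.complete d ℓ hℓ).vertex i) (2 : ℤ)) = 5 :=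
  MetricGraph.rank_two_mul_vertices rfl (by rw [Fintype.card_fin]; omega)
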